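/- Let $\mathcal H$ be a real Hilbert space and let $A:\mathcal H\to 2^{\mathcal H}$ be a maximally monotone operator whose zero set $\operatorname{zer}A=\{x: 0\in A x\}$ is nonempty. For $\lambda>0$ let $J_{\lambda A}=(I+\lambda A)^{-1}$ be the resolvent of $A$ and $A_\lambda=\frac1\lambda(I-J_{\lambda A})$ its Yosida approximation. Let $t_0>0$, $\alpha>1$, $\beta>0$ and $0<\sigma<\alpha-1$, and let $\delta,\gamma:[t_0,+\infty)\to(0,+\infty)$ be $C^1$ functions such that 1. the limit $\lim_{t\to+\infty}\frac{\gamma(t)}{t^2\delta(t)}$ exists, is finite, and is $>\frac{1}{4(\alpha-\sigma-1)\sigma}$; 2. there is $M>0$ such that $0<\frac{t\dot\delta(t)}{\delta(t)}\le M$ for all large $t$; 3. $\frac{|\dot\gamma(t)|}{\gamma(t)}=O(1/t)$ as $t\to+\infty$. Let $x:[t_0,+\infty)\to\mathcal H$ be any solution trajectory of $$\ddot x(t)+\frac{\alpha}{t}\dot x(t)+\beta\,\frac{\mathrm d}{\mathrm dt}\Big[\delta(t)A_{\gamma(t)}(x(t))\Big]+\Big(1+\frac{\beta}{t}\Big)\delta(t)A_{\gamma(t)}(x(t))=0,$$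 that is, $x$ is differentiable on $[t_0,+\infty)$, $\dot x$ is locally absolutely continuous, and the equation holds for almost every $t\ge t_0$. Then (i) $\|A_{\gamma(t)}(x(t))\|=o\big(\frac{1}{t^2\delta(t)}\big)$ as $t\to+\infty$; (ii) $\|\dot x(t)\|=o\big(\frac1t\big)$ as $t\to+\infty$; (iii) $\int_{t_0}^{+\infty}t\|\dot x(t)\|^2\,\mathrm dt<+\infty$; (iv) $\int_{t_0}^{+\infty}t^3\delta(t)^2\|A_{\gamma(t)}(x(t))\|^2\,\mathrm dt<+\infty$; (v) $x(t)$ converges weakly as $t\to+\infty$, and its limit is a zero of $A$. -/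

import Mathlib

open Set Filter Topology MeasureTheory Asymptotics
open scoped InnerProductSpace

namespace HRMMD

variable {H : Type*} [NormedAddCommGroup H] [InnerProductSpace ℝ H]

/-- A set-valued operator `A : H → 2^H` is monotone if `⟪x - y, u - v⟫ ≥ 0` for all
`u ∈ A x` and `v ∈ A y`. -/
def IsMonotone (A : H → Set H) : Prop :=
  ∀ ⦃x y u v : H⦄, u ∈ A x → v ∈ A y → 0 ≤ ⟪x - y, u - v⟫_ℝ

/-- A monotone operator is maximally monotone if its graph is not properly contained in the graph
of another monotone operator. -/
def IsMaximallyMonotone (A : H → Set H) : Prop :=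
  IsMonotone A ∧ ∀ B : H → Set H, IsMonotone B → (∀ x, A x ⊆ B x) → ∀ x, B x ⊆ A x

/-- The set of zeros of `A`. -/
def zer (A : H → Set H) : Set H := {x | (0 : H) ∈ A x}

/-- The set-valued map `(I + lam A)⁻¹`: the points `p` with `x ∈ p + lam A p`. -/
def resolventValues (A : H → Set H) (lam : ℝ) (x : H) : Set H :=
  {p | ∃ u ∈ A p, p + lam • u = x}

open Classical in
/-- The resolvent `J_{lam A} = (I + lam A)⁻¹` as a map `H → H`. For a maximally monotone `A` on a
Hilbert space and `lam > 0` the set `resolventValues A lam x` is a singleton; the value `0` in the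
other branch is a convention for operators outside this class. -/
noncomputable def resolventMap (A : H → Set H) (lam : ℝ) (x : H) : H :=
  if h : (resolventValues A lam x).Nonempty then h.choose else 0

/-- For monotone `A` and `lam > 0`, the resolvent has at most one value at each point, so that the
choice in `resolventMap` is no choice. -/
theorem resolventMap_eq {A : H → Set H} (hA : IsMonotone A) {lam : ℝ} (hlam : 0 < lam) {x p : H}
    (hp : p ∈ resolventValues A lam x) : resolventMap A lam x = p := by
  have hne : (resolventValues A lam x).Nonempty := ⟨p, hp⟩
  rw [resolventMap, dif_pos hne]
  obtain ⟨v, hv, hq⟩ := hne.choose_spec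
  obtain ⟨u, hu, hpx⟩ := hp
  generalize hne.choose = q at hv hq ⊢
  have hm := hA hv hu
  have h1 : q - p = -(lam • (v - u)) := by
    have h2 : q + lam • v = p + lam • u := hq.trans hpx.symm
    rw [smul_sub, neg_sub]
    exact sub_eq_sub_iff_add_eq_add.mpr (by rw [h2, add_comm])
  have h3 : ⟪q - p, q - p⟫_ℝ ≤ 0 := by
    nth_rw 2 [h1]
    rw [inner_neg_right, inner_smul_right]
    nlinarith
  rw [real_inner_self_eq_norm_sq] at h3
  exact sub_eq_zero.mp (norm_eq_zero.mp (by nlinarith [norm_nonneg (q - p)]))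

/-- The Yosida approximation `A_lam = (1 / lam) (I - J_{lam A})`. -/
noncomputable def yosida (A : H → Set H) (lam : ℝ) (x : H) : H :=
  (1 / lam) • (x - resolventMap A lam x)

/-- `x : [t₀, +∞) → H` is a solution trajectory of
`x'' + (α/t) x' + β d/dt [δ(t) A_{γ(t)}(x)] + (1 + β/t) δ(t) A_{γ(t)}(x) = 0`:
`x` is differentiable on `[t₀, +∞)` (one-sidedly at `t₀`), its velocity is locally absolutely
continuous, and the equation holds for almost every `t ≥ t₀`, all derivatives in it existing in the
classical sense. Only the values of `x`, `δ`, `γ` on `[t₀, +∞)` are involved. -/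
structure IsSolution (A : H → Set H) (α β t₀ : ℝ) (δ γ : ℝ → ℝ) (x : ℝ → H) : Prop where
  differentiableOn : DifferentiableOn ℝ x (Ici t₀)
  velocity_absolutelyContinuous :
    ∀ T, t₀ ≤ T → AbsolutelyContinuousOnInterval (derivWithin x (Ici t₀)) t₀ T
  equation : ∀ᵐ t ∂(volume.restrict (Ici t₀)),
    DifferentiableWithinAt ℝ (derivWithin x (Ici t₀)) (Ici t₀) t ∧
    DifferentiableWithinAt ℝ (fun s => δ s • yosida A (γ s) (x s)) (Ici t₀) t ∧
    derivWithin (derivWithin x (Ici t₀)) (Ici t₀) t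
      + (α / t) • derivWithin x (Ici t₀) t
      + β • derivWithin (fun s => δ s • yosida A (γ s) (x s)) (Ici t₀) t
      + ((1 + β / t) * δ t) • yosida A (γ t) (x t) = 0

end HRMMD

/-!
The equation is studied through `y t = δ t • A_{γ t} (x t)`, regarded as a function of time: it
reads `V' + (α/t) V + β y' + (1 + β/t) y = 0` with `V = x'`. For a zero `z` of `A`, the function
`½‖σ (x - z) + t (V + β y)‖² + ½ σ (α - 1 - σ) ‖x - z‖²` (`lyapunov`) has a derivative in which the
term `⟪x - z, V⟫` cancels, and cocoercivity of the Yosida approximation bounds `⟪x - z, y⟫` below by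
`(γ/δ)‖y‖²`. What remains is minus a quadratic form in `(V, t y)` whose discriminant has, in the
limit, the sign of `1 - 4 (α - σ - 1) σ lim γ/(t²δ) < 0`. Hence `lyapunov` converges and
`t‖V‖² + t³‖y‖²` (`energyDensity`) is integrable: `exists_tendsto_lyapunov_and_integrableOn`.

The growth conditions on `δ` and `γ`, with the Lipschitz dependence of `A_γ x` on `(γ, x)`, give
`‖y'‖ ≤ K (‖y‖/t + ‖V‖/t²)`. So the derivatives of `‖t² y‖²` and `‖t V‖²` are dominated by the
energy density, and these functions have limits; they are also integrable for `dt/t`, so the limits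
are `0` (`tendsto_zero_of_ae_abs_deriv_le`). With `t (V + β y) → 0`, convergence of `lyapunov` is
convergence of `‖x - z‖` for every zero `z`, and Opial's lemma (`exists_weak_limit_of_opial`) yields
weak convergence once weak cluster points are known to be zeros. They are, because
`A_γ x ∈ A (x - γ A_γ x)` with `γ A_γ x → 0`, and `A_γ x → 0` as `δ` is eventually increasing.

That the resolvent is everywhere defined is Minty's theorem, proved by minimizing the Fitzpatrick
function plus half the squared norm (`exists_mem_neg_self_of_maximal`). Solutions have an absolutely
continuous velocity and satisfy the equation almost everywhere only, so that all differential
inequalities are integrated for absolutely continuous functions.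
-/

/-! ### Minimizing a convex function plus half the squared norm -/

section StronglyConvex

variable {E : Type*} [NormedAddCommGroup E] [InnerProductSpace ℝ E]

/-- If `C` is the epigraph of a closed convex function `f`, then a minimizer `z` of `f + ½‖·‖²`
exists and satisfies `-z ∈ ∂f(z)`; the conclusion says this through the points of `C`. -/
theorem exists_neg_mem_subdifferential [CompleteSpace E] {C : Set (E × ℝ)} (hne : C.Nonempty)
    (hclosed : IsClosed C) (hconv : Convex ℝ C)
    (hbdd : ∀ p ∈ C, 0 ≤ p.2 + ‖p.1‖ ^ 2 / 2) :
    ∃ p ∈ C, ∀ q ∈ C, p.2 + ‖p.1‖ ^ 2 - ⟪p.1, q.1⟫_ℝ ≤ q.2 := by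
  let f : E × ℝ → ℝ := fun p => p.2 + ‖p.1‖ ^ 2 / 2
  have hfne : (f '' C).Nonempty := hne.image f
  have hfb : BddBelow (f '' C) := ⟨0, by rintro _ ⟨p, hp, rfl⟩; exact hbdd p hp⟩
  obtain ⟨m, hm⟩ : ∃ m, m = sInf (f '' C) := ⟨_, rfl⟩
  have hmle : ∀ p ∈ C, m ≤ f p := fun p hp => hm ▸ csInf_le hfb ⟨p, hp, rfl⟩
  have hex : ∀ n : ℕ, ∃ p ∈ C, f p < m + 1 / ((n : ℝ) + 1) := by
    intro n
    have hlt : sInf (f '' C) < m + 1 / ((n : ℝ) + 1) := by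
      rw [← hm]
      have : (0 : ℝ) < 1 / ((n : ℝ) + 1) := by positivity
      linarith
    obtain ⟨_, ⟨p, hp, rfl⟩, h⟩ := exists_lt_of_csInf_lt hfne hlt
    exact ⟨p, hp, h⟩
  choose p hpC hpf using hex
  -- The parallelogram law at the midpoint controls the distance of two almost minimizers.
  have hmid : ∀ a ∈ C, ∀ b ∈ C, ‖a.1 - b.1‖ ^ 2 ≤ 4 * (f a + f b - 2 * m) := by
    intro a ha b hb
    have h := hmle _ (hconv ha hb (by norm_num : (0 : ℝ) ≤ 1 / 2) (by norm_num : (0 : ℝ) ≤ 1 / 2)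
      (by norm_num))
    have hpar := parallelogram_law_with_norm ℝ a.1 b.1
    simp only [f, Prod.fst_add, Prod.snd_add, Prod.smul_fst, Prod.smul_snd, ← smul_add,
      norm_smul, smul_eq_mul] at h ⊢
    norm_num at h
    nlinarith
  have hcau : CauchySeq fun n => (p n).1 := by
    refine cauchySeq_of_le_tendsto_0 (fun n : ℕ => Real.sqrt (8 * (1 / ((n : ℝ) + 1)))) ?_ ?_
    · intro n k N hn hk
      rw [dist_eq_norm]
      apply Real.le_sqrt_of_sq_le
      have h1 : (1 : ℝ) / ((n : ℝ) + 1) ≤ 1 / ((N : ℝ) + 1) := by gcongr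
      have h2 : (1 : ℝ) / ((k : ℝ) + 1) ≤ 1 / ((N : ℝ) + 1) := by gcongr
      linarith [hmid _ (hpC n) _ (hpC k), hpf n, hpf k]
    · have h := (tendsto_one_div_add_atTop_nhds_zero_nat (𝕜 := ℝ)).const_mul 8
      have := (Real.continuous_sqrt.tendsto _).comp h
      simpa [Function.comp_def] using this
  obtain ⟨z, hz⟩ := cauchySeq_tendsto_of_complete hcau
  have hfm : Tendsto (fun n => f (p n)) atTop (𝓝 m) := by
    refine tendsto_of_tendsto_of_tendsto_of_le_of_le tendsto_const_nhds ?_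
      (fun n => hmle _ (hpC n)) (fun n => (hpf n).le)
    simpa using tendsto_const_nhds.add (tendsto_one_div_add_atTop_nhds_zero_nat (𝕜 := ℝ))
  have hr : Tendsto (fun n => (p n).2) atTop (𝓝 (m - ‖z‖ ^ 2 / 2)) := by
    refine (hfm.sub ((hz.norm.pow 2).div_const 2)).congr fun n => ?_
    simp only [f]
    ring
  have hzC : (z, m - ‖z‖ ^ 2 / 2) ∈ C :=
    hclosed.mem_of_tendsto (hz.prodMk_nhds hr) (Eventually.of_forall hpC)
  refine ⟨_, hzC, fun q hq => ?_⟩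
  -- First-order optimality along the segment from the minimizer to `q`.
  have hseg : ∀ t : ℝ, 0 < t → t ≤ 1 →
      0 ≤ (q.2 - (m - ‖z‖ ^ 2 / 2) + ⟪z, q.1 - z⟫_ℝ) + t * (‖q.1 - z‖ ^ 2 / 2) := by
    intro t ht ht1
    have h := hmle _ (hconv.add_smul_sub_mem hzC hq ⟨ht.le, ht1⟩)
    simp only [f, Prod.fst_add, Prod.snd_add, Prod.smul_fst, Prod.smul_snd, Prod.fst_sub,
      Prod.snd_sub, smul_eq_mul] at h
    rw [norm_add_sq_real, inner_smul_right, norm_smul, mul_pow, Real.norm_eq_abs, sq_abs] at h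
    have : 0 ≤ t * ((q.2 - (m - ‖z‖ ^ 2 / 2) + ⟪z, q.1 - z⟫_ℝ) + t * (‖q.1 - z‖ ^ 2 / 2)) := by
      nlinarith
    exact nonneg_of_mul_nonneg_right this ht
  have hlim : Tendsto (fun t : ℝ => (q.2 - (m - ‖z‖ ^ 2 / 2) + ⟪z, q.1 - z⟫_ℝ)
      + t * (‖q.1 - z‖ ^ 2 / 2)) (𝓝[>] 0)
      (𝓝 ((q.2 - (m - ‖z‖ ^ 2 / 2) + ⟪z, q.1 - z⟫_ℝ) + 0 * (‖q.1 - z‖ ^ 2 / 2))) :=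
    (Continuous.tendsto (by fun_prop) 0).mono_left nhdsWithin_le_nhds
  have h0 := ge_of_tendsto hlim (by
    filter_upwards [Ioc_mem_nhdsGT (zero_lt_one (α := ℝ))] with t ht using hseg t ht.1 ht.2)
  rw [inner_sub_right, real_inner_self_eq_norm_sq] at h0
  simp only
  linarith

end StronglyConvex

/-! ### Minty's theorem and the Yosida approximation -/

section Minty

variable {H : Type*} [NormedAddCommGroup H] [InnerProductSpace ℝ H]

/-- Minty's theorem, for the graph `G` of a maximally monotone operator: `0` is in the range of
`I + G`. The epigraph of the Fitzpatrick function
`F (a, b) = sup {⟪a, v⟫ + ⟪y, b⟫ - ⟪y, v⟫ | (y, v) ∈ G}` is minimized after adding half the squared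
norm; as `F ≥ ⟪·, ·⟫` everywhere and `F = ⟪·, ·⟫` on `G`, the swapped and negated minimizer
is monotonically related to `G`. -/
theorem exists_mem_neg_self_of_maximal [CompleteSpace H] {G : Set (H × H)}
    (hmono : ∀ p ∈ G, ∀ q ∈ G, 0 ≤ ⟪p.1 - q.1, p.2 - q.2⟫_ℝ)
    (hmax : ∀ p : H × H, (∀ q ∈ G, 0 ≤ ⟪p.1 - q.1, p.2 - q.2⟫_ℝ) → p ∈ G) :
    ∃ a, (a, -a) ∈ G := by
  -- Every pair is monotonically related to an empty graph, so maximality excludes it.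
  obtain ⟨g, hg⟩ : G.Nonempty := by
    by_contra! h
    have := hmax (0, 0) (by simp [h])
    simp [h] at this
  let C : Set (WithLp 2 (H × H) × ℝ) :=
    {p | ∀ q ∈ G, ⟪p.1.fst, q.2⟫_ℝ + ⟪q.1, p.1.snd⟫_ℝ - ⟪q.1, q.2⟫_ℝ ≤ p.2}
  have hCG : ∀ p ∈ G, (WithLp.toLp 2 p, ⟪p.1, p.2⟫_ℝ) ∈ C := by
    intro p hp q hq
    have := hmono p hp q hq
    simp only [inner_sub_left, inner_sub_right] at this
    change ⟪p.1, q.2⟫_ℝ + ⟪q.1, p.2⟫_ℝ - ⟪q.1, q.2⟫_ℝ ≤ ⟪p.1, p.2⟫_ℝ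
    linarith
  have hCle : ∀ p ∈ C, ⟪p.1.fst, p.1.snd⟫_ℝ ≤ p.2 := by
    intro p hp
    by_cases hpG : (p.1.fst, p.1.snd) ∈ G
    · have := hp _ hpG
      simp only at this
      linarith
    · by_contra! hlt
      refine hpG (hmax _ fun q hq => ?_)
      have := hp q hq
      simp only [inner_sub_left, inner_sub_right]
      linarith
  have hclosed : IsClosed C := by
    simp only [C, ofPred_forall]
    refine isClosed_biInter fun q _ => isClosed_le ?_ continuous_snd
    have h1 : Continuous fun p : WithLp 2 (H × H) × ℝ => p.1.fst :=
      (WithLp.prod_continuous_ofLp 2 H H).fst.comp continuous_fst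
    have h2 : Continuous fun p : WithLp 2 (H × H) × ℝ => p.1.snd :=
      (WithLp.prod_continuous_ofLp 2 H H).snd.comp continuous_fst
    fun_prop
  have hconv : Convex ℝ C := by
    intro p hp q hq s t hs ht hst r hr
    have h1 := mul_le_mul_of_nonneg_left (hp r hr) hs
    have h2 := mul_le_mul_of_nonneg_left (hq r hr) ht
    have h3 : ⟪r.1, r.2⟫_ℝ = s * ⟪r.1, r.2⟫_ℝ + t * ⟪r.1, r.2⟫_ℝ := by rw [← add_mul, hst, one_mul]
    simp only [Prod.fst_add, Prod.snd_add, Prod.smul_fst, Prod.smul_snd, WithLp.add_fst,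
      WithLp.add_snd, WithLp.smul_fst, WithLp.smul_snd, smul_eq_mul, inner_add_left,
      inner_add_right, inner_smul_left, inner_smul_right, RCLike.conj_to_real]
    linarith
  have hnn : ∀ a b : H, 0 ≤ ⟪a, b⟫_ℝ + (‖a‖ ^ 2 + ‖b‖ ^ 2) / 2 := by
    intro a b
    have := norm_add_sq_real a b
    nlinarith [sq_nonneg ‖a + b‖]
  obtain ⟨z, hzC, hz⟩ := exists_neg_mem_subdifferential ⟨_, hCG g hg⟩ hclosed hconv (by
    intro p hp
    rw [WithLp.prod_norm_sq_eq_of_L2]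
    linarith [hCle p hp, hnn p.1.fst p.1.snd])
  -- The optimality condition at `z`, tested on the graph, where the Fitzpatrick function is
  -- `⟪·, ·⟫`.
  have hrel : ∀ q ∈ G, (‖z.1.fst + z.1.snd‖ ^ 2) ≤ ⟪-z.1.snd - q.1, -z.1.fst - q.2⟫_ℝ := by
    intro q hq
    have h1 := hz _ (hCG q hq)
    have h2 := hCle z hzC
    rw [WithLp.prod_norm_sq_eq_of_L2, WithLp.prod_inner_apply] at h1
    rw [norm_add_sq_real]
    simp only [inner_sub_left, inner_sub_right, inner_neg_left, inner_neg_right] at h1 ⊢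
    change _ - (⟪z.1.fst, q.1⟫_ℝ + ⟪z.1.snd, q.2⟫_ℝ) ≤ _ at h1
    linarith [real_inner_comm q.1 z.1.fst, real_inner_comm z.1.fst z.1.snd]
  have hmem : (-z.1.snd, -z.1.fst) ∈ G :=
    hmax _ fun q hq => (sq_nonneg _).trans (hrel q hq)
  have h0 := hrel _ hmem
  simp only [sub_self, inner_zero_left] at h0
  have h1 : z.1.fst + z.1.snd = 0 := norm_eq_zero.mp (by nlinarith [norm_nonneg (z.1.fst + z.1.snd)])
  rw [← eq_neg_iff_add_eq_zero.mpr h1] at hmem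
  exact ⟨z.1.fst, hmem⟩

namespace HRMMD

theorem IsMaximallyMonotone.mem_of_forall_inner_nonneg {A : H → Set H}
    (hA : IsMaximallyMonotone A) {p u : H}
    (h : ∀ y, ∀ v ∈ A y, 0 ≤ ⟪p - y, u - v⟫_ℝ) : u ∈ A p := by
  refine hA.2 (fun q => A q ∪ {w | q = p ∧ w = u}) ?_ (fun _ => subset_union_left) p
    (Or.inr ⟨rfl, rfl⟩)
  rintro x y v w (hv | ⟨rfl, rfl⟩) (hw | ⟨rfl, rfl⟩)
  · exact hA.1 hv hw
  · rw [← inner_neg_neg, neg_sub, neg_sub]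
    exact h _ _ hv
  · exact h _ _ hw
  · simp

variable [CompleteSpace H]

theorem IsMaximallyMonotone.nonempty_resolventValues {A : H → Set H} (hA : IsMaximallyMonotone A)
    {lam : ℝ} (hlam : 0 < lam) (x : H) : (resolventValues A lam x).Nonempty := by
  obtain ⟨a, u, hu, hau⟩ := exists_mem_neg_self_of_maximal
    (G := {p : H × H | ∃ u ∈ A (p.1 + x), p.2 = lam • u}) (by
      rintro ⟨a, _⟩ ⟨u, hu, rfl⟩ ⟨b, _⟩ ⟨v, hv, rfl⟩
      have := hA.1 hu hv
      simp only at this ⊢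
      rw [add_sub_add_right_eq_sub] at this
      rw [← smul_sub, inner_smul_right]
      positivity) (by
      rintro ⟨a, b⟩ h
      refine ⟨lam⁻¹ • b, hA.mem_of_forall_inner_nonneg fun y v hv => ?_,
        (smul_inv_smul₀ hlam.ne' b).symm⟩
      have h1 := h (y - x, lam • v) ⟨v, by simpa using hv, rfl⟩
      have h2 : lam⁻¹ • b - v = lam⁻¹ • (b - lam • v) := by
        rw [smul_sub, inv_smul_smul₀ hlam.ne']
      rw [h2, inner_smul_right]
      have h3 : a + x - y = a - (y - x) := by abel
      rw [h3]
      exact mul_nonneg (inv_nonneg.mpr hlam.le) h1)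
  refine ⟨a + x, u, hu, ?_⟩
  simp only at hau
  rw [← hau]
  abel

/-- The defining inclusion `A_λ x ∈ A (x - λ A_λ x)` of the Yosida approximation. -/
theorem IsMaximallyMonotone.yosida_mem {A : H → Set H} (hA : IsMaximallyMonotone A)
    {lam : ℝ} (hlam : 0 < lam) (x : H) :
    yosida A lam x ∈ A (x - lam • yosida A lam x) := by
  obtain ⟨p, hp⟩ := hA.nonempty_resolventValues hlam x
  have hJ := resolventMap_eq hA.1 hlam hp
  obtain ⟨u, hu, rfl⟩ := hp
  have hy : yosida A lam (p + lam • u) = u := by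
    rw [yosida, hJ, add_sub_cancel_left, smul_smul, one_div_mul_cancel hlam.ne', one_smul]
  rwa [hy, add_sub_cancel_right]

/-- Cocoercivity of the Yosida approximation, tested against a zero of the operator. -/
theorem IsMaximallyMonotone.mul_norm_yosida_sq_le {A : H → Set H} (hA : IsMaximallyMonotone A)
    {lam : ℝ} (hlam : 0 < lam) {z : H} (hz : z ∈ zer A) (x : H) :
    lam * ‖yosida A lam x‖ ^ 2 ≤ ⟪x - z, yosida A lam x⟫_ℝ := by
  have h := hA.1 (hA.yosida_mem hlam x) hz
  rw [sub_zero, sub_right_comm, inner_sub_left, inner_smul_left, real_inner_self_eq_norm_sq] at h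
  simpa using h

theorem IsMaximallyMonotone.mul_norm_yosida_le {A : H → Set H} (hA : IsMaximallyMonotone A)
    {lam : ℝ} (hlam : 0 < lam) {z : H} (hz : z ∈ zer A) (x : H) :
    lam * ‖yosida A lam x‖ ≤ ‖x - z‖ := by
  have h := (hA.mul_norm_yosida_sq_le hlam hz x).trans (real_inner_le_norm _ _)
  rcases (norm_nonneg (yosida A lam x)).eq_or_lt with h0 | h0
  · rw [← h0, mul_zero]
    exact norm_nonneg _
  · exact le_of_mul_le_mul_right (by linarith) h0

/-- Joint dependence of the Yosida approximation on the point and on the parameter. -/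
theorem IsMaximallyMonotone.mul_norm_yosida_sub_le {A : H → Set H} (hA : IsMaximallyMonotone A)
    {lam mu : ℝ} (hlam : 0 < lam) (hmu : 0 < mu) (x y : H) :
    lam * ‖yosida A lam x - yosida A mu y‖ ≤ ‖x - y‖ + |lam - mu| * ‖yosida A mu y‖ := by
  have h := hA.1 (hA.yosida_mem hlam x) (hA.yosida_mem hmu y)
  generalize yosida A lam x = a at *
  generalize yosida A mu y = b at *
  have h1 : x - lam • a - (y - mu • b) = ((x - y) - (lam - mu) • b) - lam • (a - b) := by
    module
  rw [h1, inner_sub_left, inner_smul_left, real_inner_self_eq_norm_sq] at h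
  have h2 : ⟪(x - y) - (lam - mu) • b, a - b⟫_ℝ ≤ (‖x - y‖ + |lam - mu| * ‖b‖) * ‖a - b‖ := by
    refine (real_inner_le_norm _ _).trans ?_
    gcongr
    refine (norm_sub_le _ _).trans ?_
    rw [norm_smul, Real.norm_eq_abs]
  rcases (norm_nonneg (a - b)).eq_or_lt with h0 | h0
  · rw [← h0, mul_zero]
    positivity
  · simp only [RCLike.conj_to_real] at h
    exact le_of_mul_le_mul_right (by linarith) h0

end HRMMD

end Minty

/-! ### Weak limits and Opial's lemma -/

section Weak

variable {H : Type*} [NormedAddCommGroup H] [InnerProductSpace ℝ H]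

/-- Weak compactness of balls in a Hilbert space, in the language of ultrafilters. -/
theorem Ultrafilter.exists_weak_limit [CompleteSpace H] {ι : Type*} (U : Ultrafilter ι)
    {x : ι → H} {C : ℝ} (hx : ∀ᶠ t in (U : Filter ι), ‖x t‖ ≤ C) :
    ∃ p : H, ∀ w, Tendsto (fun t => ⟪x t, w⟫_ℝ) U (𝓝 ⟪p, w⟫_ℝ) := by
  have hex : ∀ w : H, ∃ c ∈ Icc (-(C * ‖w‖)) (C * ‖w‖),
      Tendsto (fun t => ⟪x t, w⟫_ℝ) U (𝓝 c) := by
    intro w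
    refine isCompact_Icc.ultrafilter_le_nhds (U.map fun t => ⟪x t, w⟫_ℝ) ?_
    rw [le_principal_iff]
    change ∀ᶠ t in (U : Filter ι), ⟪x t, w⟫_ℝ ∈ Icc (-(C * ‖w‖)) (C * ‖w‖)
    filter_upwards [hx] with t ht
    exact abs_le.mp ((abs_real_inner_le_norm _ _).trans (by gcongr))
  choose φ hφ hlim using hex
  let f : H →L[ℝ] ℝ := LinearMap.mkContinuous
    { toFun := φ
      map_add' := fun v w => tendsto_nhds_unique (hlim (v + w)) (by
        simpa only [inner_add_right] using (hlim v).add (hlim w))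
      map_smul' := fun c w => tendsto_nhds_unique (hlim (c • w)) (by
        simpa only [inner_smul_right, RingHom.id_apply, smul_eq_mul] using (hlim w).const_mul c) } C
      (fun w => abs_le.mpr (hφ w))
  refine ⟨(InnerProductSpace.toDual ℝ H).symm f, fun w => ?_⟩
  rw [InnerProductSpace.toDual_symm_apply]
  exact hlim w

/-- Opial's lemma. The hypothesis on weak cluster points is phrased with ultrafilters, which makes
subsequences and separability unnecessary. -/
theorem exists_weak_limit_of_opial [CompleteSpace H] {ι : Type*} {l : Filter ι} [l.NeBot]
    {S : Set H} (hS : S.Nonempty) {x : ι → H}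
    (hdist : ∀ z ∈ S, ∃ d, Tendsto (fun t => ‖x t - z‖ ^ 2) l (𝓝 d))
    (hcluster : ∀ U : Ultrafilter ι, ↑U ≤ l → ∀ p : H,
      (∀ w, Tendsto (fun t => ⟪x t, w⟫_ℝ) U (𝓝 ⟪p, w⟫_ℝ)) → p ∈ S) :
    ∃ p ∈ S, ∀ w, Tendsto (fun t => ⟪x t, w⟫_ℝ) l (𝓝 ⟪p, w⟫_ℝ) := by
  obtain ⟨z, hz⟩ := hS
  obtain ⟨d, hd⟩ := hdist z hz
  have hbdd : ∀ᶠ t in l, ‖x t‖ ≤ Real.sqrt (d + 1) + ‖z‖ := by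
    filter_upwards [hd.eventually_le_const (lt_add_one d)] with t ht
    have h1 : ‖x t - z‖ ≤ Real.sqrt (d + 1) := Real.le_sqrt_of_sq_le ht
    calc ‖x t‖ = ‖(x t - z) + z‖ := by rw [sub_add_cancel]
      _ ≤ ‖x t - z‖ + ‖z‖ := norm_add_le _ _
      _ ≤ _ := by gcongr
  have hex : ∀ U : Ultrafilter ι, ↑U ≤ l → ∃ p ∈ S,
      ∀ w, Tendsto (fun t => ⟪x t, w⟫_ℝ) U (𝓝 ⟪p, w⟫_ℝ) := by
    intro U hU
    obtain ⟨p, hp⟩ := U.exists_weak_limit (hU hbdd)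
    exact ⟨p, hcluster U hU p hp, hp⟩
  -- `⟪x t, p - q⟫` converges along `l` for `p, q ∈ S`, so it cannot separate two cluster points.
  have hpair : ∀ p ∈ S, ∀ q ∈ S, ∃ c, Tendsto (fun t => ⟪x t, p - q⟫_ℝ) l (𝓝 c) := by
    intro p hp q hq
    obtain ⟨c, hc⟩ := hdist p hp
    obtain ⟨e, he⟩ := hdist q hq
    refine ⟨_, (((he.sub hc).sub_const (‖q‖ ^ 2 - ‖p‖ ^ 2)).div_const 2).congr fun t => ?_⟩
    rw [norm_sub_sq_real, norm_sub_sq_real, inner_sub_right]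
    ring
  obtain ⟨p, hpS, hp⟩ := hex (Ultrafilter.of l) (Ultrafilter.of_le l)
  refine ⟨p, hpS, fun w => (tendsto_iff_ultrafilter _ _ _).mpr fun U hU => ?_⟩
  obtain ⟨q, hqS, hq⟩ := hex U hU
  obtain ⟨c, hc⟩ := hpair p hpS q hqS
  have h1 := tendsto_nhds_unique (hp (p - q)) (hc.mono_left (Ultrafilter.of_le l))
  have h2 := tendsto_nhds_unique (hq (p - q)) (hc.mono_left hU)
  have h3 : p = q := by
    rw [← sub_eq_zero, ← inner_self_eq_zero (𝕜 := ℝ), inner_sub_left, h1, h2, sub_self]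
  rw [h3]
  exact hq w

theorem tendsto_toWeakSpace_of_forall_inner [CompleteSpace H] {ι : Type*} {l : Filter ι}
    {x : ι → H} {p : H} (h : ∀ w, Tendsto (fun t => ⟪x t, w⟫_ℝ) l (𝓝 ⟪p, w⟫_ℝ)) :
    Tendsto (fun t => toWeakSpace ℝ H (x t)) l (𝓝 (toWeakSpace ℝ H p)) := by
  have hinj : Function.Injective (topDualPairing ℝ H).flip := by
    intro a b hab
    have h1 := LinearMap.congr_fun hab (innerSL ℝ (a - b))
    simp only [LinearMap.flip_apply, topDualPairing_apply, innerSL_apply_apply] at h1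
    rw [← sub_eq_zero, ← inner_sub_right, inner_self_eq_zero] at h1
    rwa [sub_eq_zero] at h1
  refine (WeakBilin.tendsto_iff_forall_eval_tendsto _ hinj).mpr fun f => ?_
  have hf : ∀ y, f y = ⟪y, (InnerProductSpace.toDual ℝ H).symm f⟫_ℝ := fun y => by
    rw [real_inner_comm, InnerProductSpace.toDual_symm_apply]
  change Tendsto (fun t => f (x t)) l (𝓝 (f p))
  simpa only [hf] using h ((InnerProductSpace.toDual ℝ H).symm f)

/-- The graph of a maximally monotone operator is closed for weak convergence of points and strong
convergence of values; here with values tending to `0`. -/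
theorem HRMMD.IsMaximallyMonotone.mem_zer_of_weak_limit {A : H → Set H}
    (hA : IsMaximallyMonotone A) {ι : Type*} {l : Filter ι} [l.NeBot] {J a : ι → H} {p : H}
    {C : ℝ} (ha : ∀ᶠ t in l, a t ∈ A (J t)) (hJ : ∀ᶠ t in l, ‖J t‖ ≤ C)
    (hJp : ∀ w, Tendsto (fun t => ⟪J t, w⟫_ℝ) l (𝓝 ⟪p, w⟫_ℝ)) (ha0 : Tendsto a l (𝓝 0)) :
    p ∈ zer A := by
  refine hA.mem_of_forall_inner_nonneg fun y v hv => ?_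
  have h1 : Tendsto (fun t => ⟪J t, a t⟫_ℝ) l (𝓝 0) := by
    refine squeeze_zero_norm' (a := fun t => C * ‖a t‖) ?_ (by simpa using ha0.norm.const_mul C)
    filter_upwards [hJ] with t ht
    exact (norm_inner_le_norm _ _).trans (by gcongr)
  have h2 : Tendsto (fun t => ⟪J t, a t⟫_ℝ - ⟪y, a t⟫_ℝ - (⟪J t, v⟫_ℝ - ⟪y, v⟫_ℝ)) l
      (𝓝 (0 - ⟪y, (0 : H)⟫_ℝ - (⟪p, v⟫_ℝ - ⟪y, v⟫_ℝ))) :=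
    (h1.sub (tendsto_const_nhds.inner ha0)).sub ((hJp v).sub_const _)
  have h3 : ⟪p - y, 0 - v⟫_ℝ = 0 - ⟪y, (0 : H)⟫_ℝ - (⟪p, v⟫_ℝ - ⟪y, v⟫_ℝ) := by
    simp only [inner_sub_left, inner_sub_right, inner_zero_right]
    ring
  rw [h3]
  refine ge_of_tendsto h2 ?_
  filter_upwards [ha] with t ht
  have := hA.1 ht hv
  simp only [inner_sub_left, inner_sub_right] at this
  linarith

end Weak

/-! ### Absolutely continuous functions on a half-line -/

section AbsolutelyContinuous

theorem AbsolutelyContinuousOnInterval.norm {F : Type*} [NormedAddCommGroup F] {f : ℝ → F}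
    {a b : ℝ} (hf : AbsolutelyContinuousOnInterval f a b) :
    AbsolutelyContinuousOnInterval (fun t => ‖f t‖) a b :=
  squeeze_zero (fun _ => Finset.sum_nonneg fun _ _ => dist_nonneg)
    (fun _ => Finset.sum_le_sum fun _ _ => by
      rw [Real.dist_eq, dist_eq_norm]
      exact abs_norm_sub_norm_le _ _) hf

theorem AbsolutelyContinuousOnInterval.norm_sq {F : Type*} [NormedAddCommGroup F] {f : ℝ → F}
    {a b : ℝ} (hf : AbsolutelyContinuousOnInterval f a b) :
    AbsolutelyContinuousOnInterval (fun t => ‖f t‖ ^ 2) a b := by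
  simpa only [pow_two] using hf.norm.fun_mul hf.norm

variable {f g : ℝ → ℝ} {a : ℝ}

/-- Integrated form of the differential inequality `f' + g ≤ 0`. -/
theorem add_integral_le_of_ae_deriv_le {b : ℝ} (hab : a ≤ b)
    (hf : AbsolutelyContinuousOnInterval f a b) (hg : IntervalIntegrable g volume a b)
    (hfg : ∀ᵐ t, a < t → ∃ f', HasDerivAt f f' t ∧ f' ≤ -g t) :
    f b + ∫ t in a..b, g t ≤ f a := by
  have h : ∫ t in a..b, deriv f t ≤ ∫ t in a..b, -g t := by
    refine intervalIntegral.integral_mono_ae_restrict hab hf.intervalIntegrable_deriv hg.neg ?_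
    rw [EventuallyLE, ae_restrict_iff' measurableSet_Icc]
    filter_upwards [hfg, compl_mem_ae_iff.mpr (measure_singleton a)] with t ht hta htI
    obtain ⟨f', hf', hle⟩ := ht (lt_of_le_of_ne htI.1 (Ne.symm hta))
    rwa [hf'.deriv]
  rw [hf.integral_deriv_eq_sub, intervalIntegral.integral_neg] at h
  linarith

/-- A nonnegative Lyapunov function converges, and its dissipation rate is integrable. -/
theorem exists_tendsto_and_integrableOn_of_ae_deriv_le
    (hf : ∀ b, a ≤ b → AbsolutelyContinuousOnInterval f a b) (hf0 : ∀ t, 0 ≤ f t)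
    (hg : ContinuousOn g (Ici a)) (hg0 : ∀ t, a ≤ t → 0 ≤ g t)
    (hfg : ∀ᵐ t, a < t → ∃ f', HasDerivAt f f' t ∧ f' ≤ -g t) :
    (∃ l, Tendsto f atTop (𝓝 l)) ∧ IntegrableOn g (Ioi a) := by
  have hgi : ∀ b c, a ≤ b → b ≤ c → IntervalIntegrable g volume b c := fun b c hb hc =>
    (hg.mono (by rw [uIcc_of_le hc]; exact fun t ht => hb.trans ht.1)).intervalIntegrable
  have hkey : ∀ b c, a ≤ b → b ≤ c → f c + ∫ t in b..c, g t ≤ f b := fun b c hb hc =>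
    add_integral_le_of_ae_deriv_le hc
      ((hf c (hb.trans hc)).mono (by
        rw [uIcc_of_le hc, uIcc_of_le (hb.trans hc)]; exact Icc_subset_Icc_left hb))
      (hgi b c hb hc) (hfg.mono fun t ht htb => ht (hb.trans_lt htb))
  have hint0 : ∀ b c, a ≤ b → b ≤ c → 0 ≤ ∫ t in b..c, g t := fun b c hb hc =>
    intervalIntegral.integral_nonneg hc fun t ht => hg0 t (hb.trans ht.1)
  constructor
  · have hanti : Antitone fun t => f (max t a) := fun b c hbc => by
      have h1 : max b a ≤ max c a := max_le_max_right a hbc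
      linarith [hkey _ _ (le_max_right b a) h1, hint0 _ _ (le_max_right b a) h1]
    refine ⟨_, (tendsto_atTop_ciInf hanti ⟨0, ?_⟩).congr' ?_⟩
    · rintro _ ⟨t, rfl⟩
      exact hf0 _
    · filter_upwards [eventually_ge_atTop a] with t ht
      rw [max_eq_left ht]
  · refine integrableOn_Ioi_of_intervalIntegral_norm_bounded (l := atTop)
      (b := fun t : ℝ => max t a) (f a) a
      (fun t => (intervalIntegrable_iff_integrableOn_Ioc_of_le (le_max_right t a)).mp
        (hgi a _ le_rfl (le_max_right t a)))
      (tendsto_atTop_mono (fun t => le_max_left t a) tendsto_id) (Eventually.of_forall fun t => ?_)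
    have h1 : ∫ s in a..max t a, ‖g s‖ = ∫ s in a..max t a, g s := by
      refine intervalIntegral.integral_congr fun s hs => ?_
      rw [uIcc_of_le (le_max_right t a)] at hs
      exact Real.norm_of_nonneg (hg0 s hs.1)
    rw [h1]
    linarith [hkey a _ le_rfl (le_max_right t a), hf0 (max t a)]

/-- A nonnegative function with integrable derivative has a limit; the limit is `0` if moreover the
function is integrable for the measure `dt / t`. -/
theorem tendsto_zero_of_ae_abs_deriv_le
    (hf : ∀ b, a ≤ b → AbsolutelyContinuousOnInterval f a b) (hf0 : ∀ t, 0 ≤ f t) (ha : 0 < a)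
    (hg : IntegrableOn g (Ioi a))
    (hfg : ∀ᵐ t, a < t → ∃ f', HasDerivAt f f' t ∧ |f'| ≤ g t)
    (hft : ∀ t, a < t → f t / t ≤ g t) :
    Tendsto f atTop (𝓝 0) := by
  have hd : IntegrableOn (deriv f) (Ioi a) := by
    refine hg.mono' (measurable_deriv f).aestronglyMeasurable ?_
    rw [ae_restrict_iff' measurableSet_Ioi]
    filter_upwards [hfg] with t ht hta
    obtain ⟨f', hf', hle⟩ := ht hta
    rwa [hf'.deriv]
  have hlim : Tendsto f atTop (𝓝 (f a + ∫ t in Ioi a, deriv f t)) := by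
    refine ((intervalIntegral_tendsto_integral_Ioi a hd tendsto_id).const_add (f a)).congr' ?_
    filter_upwards [eventually_ge_atTop a] with t ht
    rw [id, (hf t ht).integral_deriv_eq_sub]
    ring
  generalize f a + ∫ t in Ioi a, deriv f t = l at hlim
  have hl0 : 0 ≤ l := ge_of_tendsto' hlim hf0
  rcases hl0.eq_or_lt with rfl | hl
  · exact hlim
  -- Otherwise `1 / t ≤ (2 / l) * g t` for large `t`, and `1 / t` would be integrable.
  exfalso
  obtain ⟨b, hb⟩ := eventually_atTop.mp (hlim.eventually_const_le (half_lt_self hl))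
  refine not_integrableOn_Ioi_inv (a := max a b) ?_
  refine ((hg.mono_set (Ioi_subset_Ioi (le_max_left a b))).const_mul (2 / l)).mono'
    measurable_inv.aestronglyMeasurable ?_
  rw [ae_restrict_iff' measurableSet_Ioi]
  refine Eventually.of_forall fun t ht => ?_
  have hta : a < t := (le_max_left a b).trans_lt ht
  have htb : b ≤ t := ((le_max_right a b).trans_lt ht).le
  have ht0 : 0 < t := ha.trans hta
  rw [Real.norm_of_nonneg (inv_nonneg.mpr ht0.le)]
  have h1 : l / 2 * t⁻¹ ≤ g t := (mul_le_mul_of_nonneg_right (hb t htb) (inv_nonneg.mpr ht0.le)).trans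
    (hft t hta)
  calc t⁻¹ = 2 / l * (l / 2 * t⁻¹) := by field_simp
    _ ≤ 2 / l * g t := by gcongr

end AbsolutelyContinuous

/-! ### The quadratic form governing the dissipation -/

/-- Strict positivity of the limiting discriminant `4 κ σ L - 1` makes the dissipation form
uniformly coercive for large times. -/
theorem exists_eventually_le_quadratic_form {κ σ β L : ℝ} (hκ : 0 < κ) (hσ : 0 < σ)
    (hL : 1 / (4 * κ * σ) < L) {θ : ℝ → ℝ} (hθ : Tendsto (fun t => θ t / t ^ 2) atTop (𝓝 L)) :
    ∃ ε > 0, ∀ᶠ t in atTop, ∀ A B : ℝ, ε * (t * A ^ 2 + t ^ 3 * B ^ 2) ≤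
      κ * t * A ^ 2 - (t ^ 2 + β * κ * t) * (A * B) + σ * t * θ t * B ^ 2 := by
  have hdisc : 1 < 4 * κ * (σ * L) := by
    rw [div_lt_iff₀ (by positivity)] at hL
    linarith
  -- There is room for a small `ε` in both diagonal entries.
  obtain ⟨ε, hε, hεκ, hεd⟩ : ∃ ε : ℝ, 0 < ε ∧ ε < κ ∧ 1 < 4 * (κ - ε) * (σ * L - ε) := by
    have hc : Tendsto (fun ε : ℝ => 4 * (κ - ε) * (σ * L - ε)) (𝓝[>] 0)
        (𝓝 (4 * (κ - 0) * (σ * L - 0))) :=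
      (Continuous.tendsto (by fun_prop) 0).mono_left nhdsWithin_le_nhds
    rw [sub_zero, sub_zero] at hc
    obtain ⟨ε, h1, h2⟩ := ((hc.eventually_const_lt hdisc).and (Ioo_mem_nhdsGT hκ)).exists
    exact ⟨ε, h2.1, h2.2, h1⟩
  refine ⟨ε, hε, ?_⟩
  have hlim : Tendsto (fun t => 4 * (κ - ε) * (σ * (θ t / t ^ 2) - ε) - (1 + β * κ * t⁻¹) ^ 2) atTop
      (𝓝 (4 * (κ - ε) * (σ * L - ε) - (1 + β * κ * 0) ^ 2)) :=
    (((hθ.const_mul σ).sub_const ε).const_mul _).sub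
      (((tendsto_inv_atTop_zero.const_mul (β * κ)).const_add 1).pow 2)
  filter_upwards [hlim.eventually_const_lt (u := 0) (by linarith), eventually_gt_atTop 0]
    with t ht ht0 A B
  obtain ⟨q, hq⟩ : ∃ q, q = σ * (θ t / t ^ 2) - ε := ⟨_, rfl⟩
  obtain ⟨c, hc⟩ : ∃ c, c = 1 + β * κ * t⁻¹ := ⟨_, rfl⟩
  rw [← hq, ← hc] at ht
  have hkey : 0 ≤ (κ - ε) * A ^ 2 - c * A * (t * B) + q * (t * B) ^ 2 := by
    have h1 : 0 ≤ 4 * (κ - ε) * ((κ - ε) * A ^ 2 - c * A * (t * B) + q * (t * B) ^ 2) := by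
      have h2 : 0 ≤ (4 * (κ - ε) * q - c ^ 2) * (t * B) ^ 2 := by positivity
      nlinarith [sq_nonneg (2 * (κ - ε) * A - c * (t * B))]
    exact nonneg_of_mul_nonneg_right h1 (by linarith)
  have h3 : κ * t * A ^ 2 - (t ^ 2 + β * κ * t) * (A * B) + σ * t * θ t * B ^ 2
      - ε * (t * A ^ 2 + t ^ 3 * B ^ 2)
      = t * ((κ - ε) * A ^ 2 - c * A * (t * B) + q * (t * B) ^ 2) := by
    rw [hq, hc]
    field_simp
    ring
  have := mul_nonneg ht0.le hkey
  linarith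

/-! ### Lyapunov analysis of the damped system -/

theorem continuousOn_Ici_of_absolutelyContinuous {F : Type*} [NormedAddCommGroup F] {f : ℝ → F}
    {t₀ : ℝ} (hf : ∀ T, t₀ ≤ T → AbsolutelyContinuousOnInterval f t₀ T) : ContinuousOn f (Ici t₀) := by
  intro t ht
  have h := (hf (t + 1) (by linarith [mem_Ici.mp ht])).continuousOn
  rw [uIcc_of_le (by linarith [mem_Ici.mp ht])] at h
  refine (h t ⟨ht, by linarith⟩).mono_of_mem_nhdsWithin ?_
  filter_upwards [self_mem_nhdsWithin, mem_nhdsWithin_of_mem_nhds (Iio_mem_nhds (lt_add_one t))]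
    with s hs hs' using ⟨hs, (mem_Iio.mp hs').le⟩

/-- The time-weighted energy density controlling all integrals of the analysis. -/
noncomputable def energyDensity {F : Type*} [NormedAddCommGroup F] (V y : ℝ → F) (t : ℝ) : ℝ :=
  t * ‖V t‖ ^ 2 + t ^ 3 * ‖y t‖ ^ 2

theorem sq_mul_norm_mul_norm_le {F : Type*} [NormedAddCommGroup F] {V y : ℝ → F} {t : ℝ}
    (ht : 0 ≤ t) :
    t ^ 2 * (‖V t‖ * ‖y t‖) ≤ energyDensity V y t / 2 := by
  have h := mul_nonneg ht (sq_nonneg (‖V t‖ - t * ‖y t‖))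
  rw [energyDensity]
  linarith

section Dynamics

variable {H : Type*} [NormedAddCommGroup H] [InnerProductSpace ℝ H]

/-- Absolutely continuous solutions of `V' + (α/t) V + β y' + (1 + β/t) y = 0`, `x' = V`, with the
forcing term `y` regarded as a function of time only. -/
structure IsDampedTrajectory (α β t₀ : ℝ) (x V y : ℝ → H) : Prop where
  hasDerivAt : ∀ t, t₀ < t → HasDerivAt x (V t) t
  ac_position : ∀ T, t₀ ≤ T → AbsolutelyContinuousOnInterval x t₀ T
  ac_velocity : ∀ T, t₀ ≤ T → AbsolutelyContinuousOnInterval V t₀ T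
  ac_forcing : ∀ T, t₀ ≤ T → AbsolutelyContinuousOnInterval y t₀ T
  equation : ∀ᵐ t, t₀ < t → ∃ V' y', HasDerivAt V V' t ∧ HasDerivAt y y' t ∧
    V' + (α / t) • V t + β • y' + (1 + β / t) • y t = 0

/-- The Lyapunov function anchored at `z`. -/
noncomputable def lyapunov (α β σ : ℝ) (x V y : ℝ → H) (z : H) (t : ℝ) : ℝ :=
  1 / 2 * ‖σ • (x t - z) + t • (V t + β • y t)‖ ^ 2 + σ * (α - 1 - σ) / 2 * ‖x t - z‖ ^ 2

/-- The choice of coefficients in `lyapunov` cancels the term `⟪x - z, V⟫` in its derivative. -/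
theorem hasDerivAt_lyapunov {α β σ t : ℝ} (ht : 0 < t) {x V y : ℝ → H} {V' y' : H} (z : H)
    (hx : HasDerivAt x (V t) t) (hV : HasDerivAt V V' t) (hy : HasDerivAt y y' t)
    (heq : V' + (α / t) • V t + β • y' + (1 + β / t) • y t = 0) :
    HasDerivAt (lyapunov α β σ x V y z)
      (-(σ * t * ⟪x t - z, y t⟫_ℝ) - (α - 1 - σ) * t * ‖V t‖ ^ 2
        - (t ^ 2 + β * (α - 1 - σ) * t) * ⟪V t, y t⟫_ℝ - β * t ^ 2 * ‖y t‖ ^ 2) t := by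
  have h1 : HasDerivAt (fun s => σ • (x s - z) + s • (V s + β • y s))
      ((σ + 1 - α) • V t - t • y t) t := by
    refine (((hx.sub_const z).const_smul σ).add
      ((hasDerivAt_id t).smul (hV.add (hy.const_smul β)))).congr_deriv ?_
    have h2 : V' + β • y' = -((α / t) • V t + (1 + β / t) • y t) := by
      rw [eq_neg_iff_add_eq_zero, ← heq]
      abel
    simp only [id, Pi.add_apply, Pi.smul_apply]
    rw [h2]
    match_scalars <;> field_simp <;> ring
  refine ((h1.norm_sq.const_mul (1 / 2)).add
    ((hx.sub_const z).norm_sq.const_mul (σ * (α - 1 - σ) / 2))).congr_deriv ?_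
  simp only [inner_add_left, inner_sub_right, inner_smul_left, inner_smul_right,
    RCLike.conj_to_real, real_inner_self_eq_norm_sq, real_inner_comm (V t) (y t)]
  ring

variable {α β σ t₀ : ℝ} {x V y : ℝ → H}

namespace IsDampedTrajectory

theorem continuousOn_energyDensity (h : IsDampedTrajectory α β t₀ x V y) :
    ContinuousOn (energyDensity V y) (Ici t₀) := by
  have h1 := continuousOn_Ici_of_absolutelyContinuous h.ac_velocity
  have h2 := continuousOn_Ici_of_absolutelyContinuous h.ac_forcing
  unfold energyDensity
  fun_prop

theorem ac_lyapunov (h : IsDampedTrajectory α β t₀ x V y) (z : H) {T : ℝ} (hT : t₀ ≤ T) :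
    AbsolutelyContinuousOnInterval (lyapunov α β σ x V y z) t₀ T := by
  have hx : AbsolutelyContinuousOnInterval (fun t => x t - z) t₀ T :=
    (h.ac_position T hT).fun_sub
      (contDiff_const (c := z)).contDiffOn.absolutelyContinuousOnInterval
  have hid : AbsolutelyContinuousOnInterval (fun t : ℝ => t) t₀ T :=
    contDiff_id.contDiffOn.absolutelyContinuousOnInterval
  exact (((hx.const_smul σ).fun_add (hid.fun_smul ((h.ac_velocity T hT).fun_add
    ((h.ac_forcing T hT).const_smul β)))).norm_sq.const_mul (1 / 2)).fun_add
    (hx.norm_sq.const_mul _)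

/-- Cocoercivity of the forcing with modulus `θ ~ L t²`, `L > 1 / (4 (α - σ - 1) σ)`, makes
`lyapunov` decrease and the energy density integrable. -/
theorem exists_tendsto_lyapunov_and_integrableOn (h : IsDampedTrajectory α β t₀ x V y)
    (ht₀ : 0 < t₀) (hβ : 0 < β) (hσ : 0 < σ) (hσα : σ < α - 1) {L : ℝ}
    (hL : 1 / (4 * (α - σ - 1) * σ) < L) {θ : ℝ → ℝ}
    (hθ : Tendsto (fun t => θ t / t ^ 2) atTop (𝓝 L)) {z : H}
    (hz : ∀ t, t₀ ≤ t → θ t * ‖y t‖ ^ 2 ≤ ⟪x t - z, y t⟫_ℝ) :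
    (∃ l, Tendsto (lyapunov α β σ x V y z) atTop (𝓝 l)) ∧
      IntegrableOn (energyDensity V y) (Ioi t₀) := by
  have hκ : 0 < α - 1 - σ := by linarith
  rw [sub_right_comm] at hL
  obtain ⟨ε, hε, hev⟩ := exists_eventually_le_quadratic_form (β := β) hκ hσ hL hθ
  obtain ⟨T, hT⟩ := eventually_atTop.mp hev
  obtain ⟨a, ha⟩ : ∃ a, a = max t₀ T := ⟨_, rfl⟩
  have hta : t₀ ≤ a := ha ▸ le_max_left _ _
  have hTa : T ≤ a := ha ▸ le_max_right _ _
  have hw := h.continuousOn_energyDensity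
  obtain ⟨hl, hi⟩ := exists_tendsto_and_integrableOn_of_ae_deriv_le
    (f := lyapunov α β σ x V y z) (g := fun t => ε * energyDensity V y t) (a := a)
    (fun b hb => (h.ac_lyapunov z (hta.trans hb)).mono (by
      rw [uIcc_of_le hb, uIcc_of_le (hta.trans hb)]
      exact Icc_subset_Icc_left hta))
    (fun t => by unfold lyapunov; positivity)
    (continuousOn_const.mul (hw.mono (Ici_subset_Ici.mpr hta)))
    (fun t ht => by
      have : 0 < t := ht₀.trans_le (hta.trans ht)
      unfold energyDensity
      positivity)
    (by
      filter_upwards [h.equation] with t ht hat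
      have htt : t₀ < t := hta.trans_lt hat
      have ht0 : 0 < t := ht₀.trans htt
      obtain ⟨V', y', hV, hy, heq⟩ := ht htt
      refine ⟨_, hasDerivAt_lyapunov ht0 z (h.hasDerivAt t htt) hV hy heq, ?_⟩
      have h1 := hT t (hTa.trans hat.le) ‖V t‖ ‖y t‖
      have h2 := mul_le_mul_of_nonneg_left (hz t htt.le) (mul_pos hσ ht0).le
      have h3 := mul_le_mul_of_nonneg_left (neg_le_of_abs_le (abs_real_inner_le_norm (V t) (y t)))
        (show 0 ≤ t ^ 2 + β * (α - 1 - σ) * t by positivity)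
      have h4 : 0 ≤ β * t ^ 2 * ‖y t‖ ^ 2 := by positivity
      rw [energyDensity]
      linarith)
  refine ⟨hl, ?_⟩
  have hi' : IntegrableOn (energyDensity V y) (Ioi a) := by
    refine IntegrableOn.congr_fun (hi.const_mul ε⁻¹) (fun t _ => ?_) measurableSet_Ioi
    exact inv_mul_cancel_left₀ hε.ne' _
  rw [← Ioc_union_Ioi_eq_Ioi hta]
  exact (((hw.mono Icc_subset_Ici_self).integrableOn_compact isCompact_Icc).mono_set
    Ioc_subset_Icc_self).union hi'

/-- If the forcing varies slowly along the trajectory, integrability of the energy density improves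
to pointwise decay of the forcing. -/
theorem tendsto_sq_mul_norm_forcing (h : IsDampedTrajectory α β t₀ x V y) (ht₀ : 0 < t₀)
    {a K : ℝ} (hta : t₀ ≤ a) (hK : 0 ≤ K)
    (hint : IntegrableOn (energyDensity V y) (Ioi t₀))
    (hy' : ∀ᵐ t, a < t → ∀ y', HasDerivAt y y' t → ‖y'‖ ≤ K / t * ‖y t‖ + K / t ^ 2 * ‖V t‖) :
    Tendsto (fun t => t ^ 2 * ‖y t‖) atTop (𝓝 0) := by
  have key : Tendsto (fun t => ‖t ^ 2 • y t‖ ^ 2) atTop (𝓝 0) := by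
    refine tendsto_zero_of_ae_abs_deriv_le (a := a)
      (g := fun t => (4 + 3 * K) * energyDensity V y t) (fun b hb => ?_) (fun t => by positivity)
      (ht₀.trans_le hta) ((hint.mono_set (Ioi_subset_Ioi hta)).const_mul _) ?_ ?_
    · have hsq : AbsolutelyContinuousOnInterval (fun t : ℝ => t ^ 2) a b :=
        (contDiff_id.pow 2).contDiffOn.absolutelyContinuousOnInterval
      exact (hsq.fun_smul ((h.ac_forcing b (hta.trans hb)).mono (by
        rw [uIcc_of_le hb, uIcc_of_le (hta.trans hb)]
        exact Icc_subset_Icc_left hta))).norm_sq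
    · filter_upwards [h.equation, hy'] with t ht hyt hat
      have htt : t₀ < t := hta.trans_lt hat
      have ht0 : 0 < t := ht₀.trans htt
      obtain ⟨V', y', hV, hy, -⟩ := ht htt
      refine ⟨_, ((hasDerivAt_pow 2 t).smul hy).norm_sq, ?_⟩
      have h1 := hyt hat y' hy
      have h2 := sq_mul_norm_mul_norm_le (V := V) (y := y) ht0.le
      have h3 : |⟪y t, y'⟫_ℝ| ≤ ‖y t‖ * (K / t * ‖y t‖ + K / t ^ 2 * ‖V t‖) :=
        (abs_real_inner_le_norm _ _).trans (by gcongr)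
      have h4 : 0 ≤ t * ‖V t‖ ^ 2 := by positivity
      have h5 : 2 * t ^ 4 * (‖y t‖ * (K / t * ‖y t‖ + K / t ^ 2 * ‖V t‖))
          = K * (2 * (t ^ 3 * ‖y t‖ ^ 2) + 2 * (t ^ 2 * (‖V t‖ * ‖y t‖))) := by
        field_simp
      have h6 : 2 * ⟪t ^ 2 • y t, t ^ 2 • y' + (((2 : ℕ) : ℝ) * t ^ (2 - 1)) • y t⟫_ℝ
          = 4 * (t ^ 3 * ‖y t‖ ^ 2) + 2 * t ^ 4 * ⟪y t, y'⟫_ℝ := by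
        simp only [inner_add_right, inner_smul_left, inner_smul_right, RCLike.conj_to_real,
          real_inner_self_eq_norm_sq]
        push_cast
        ring
      simp only [Pi.smul_apply']
      rw [h6]
      have h7 : |2 * t ^ 4 * ⟪y t, y'⟫_ℝ|
          ≤ 2 * t ^ 4 * (‖y t‖ * (K / t * ‖y t‖ + K / t ^ 2 * ‖V t‖)) := by
        rw [abs_mul, abs_of_pos (show 0 < 2 * t ^ 4 by positivity)]
        gcongr
      rw [h5] at h7
      have h8 : 0 ≤ t ^ 3 * ‖y t‖ ^ 2 := by positivity
      have h9 : 2 * (t ^ 3 * ‖y t‖ ^ 2) + 2 * (t ^ 2 * (‖V t‖ * ‖y t‖))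
          ≤ 3 * energyDensity V y t := by
        rw [energyDensity] at h2 ⊢
        linarith
      have h10 := mul_le_mul_of_nonneg_left h9 hK
      have h11 : 4 * (t ^ 3 * ‖y t‖ ^ 2) ≤ 4 * energyDensity V y t := by
        rw [energyDensity]
        linarith
      refine (abs_add_le _ _).trans ?_
      rw [abs_of_nonneg (show 0 ≤ 4 * (t ^ 3 * ‖y t‖ ^ 2) by positivity)]
      linarith
    · intro t hat
      have ht0 : 0 < t := ht₀.trans (hta.trans_lt hat)
      have h1 : ‖t ^ 2 • y t‖ ^ 2 / t = t ^ 3 * ‖y t‖ ^ 2 := by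
        rw [norm_smul, Real.norm_of_nonneg (by positivity)]
        field_simp
      have h2 : 0 ≤ t * ‖V t‖ ^ 2 := by positivity
      have h3 : 0 ≤ energyDensity V y t := by unfold energyDensity; positivity
      have h4 : 0 ≤ K * energyDensity V y t := by positivity
      have h5 : t ^ 3 * ‖y t‖ ^ 2 ≤ energyDensity V y t := by rw [energyDensity]; linarith
      rw [h1]
      linarith
  have h := key.sqrt
  simpa [Real.sqrt_sq_eq_abs, norm_smul] using h

/-- The same improvement for the velocity, whose derivative is read off the equation. -/
theorem tendsto_mul_norm_velocity (h : IsDampedTrajectory α β t₀ x V y) (ht₀ : 0 < t₀)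
    (hα : 0 ≤ α) (hβ : 0 ≤ β) {a K : ℝ} (hta : t₀ ≤ a) (ha1 : 1 ≤ a) (hK : 0 ≤ K)
    (hint : IntegrableOn (energyDensity V y) (Ioi t₀))
    (hy' : ∀ᵐ t, a < t → ∀ y', HasDerivAt y y' t → ‖y'‖ ≤ K / t * ‖y t‖ + K / t ^ 2 * ‖V t‖) :
    Tendsto (fun t => t * ‖V t‖) atTop (𝓝 0) := by
  have key : Tendsto (fun t => ‖t • V t‖ ^ 2) atTop (𝓝 0) := by
    refine tendsto_zero_of_ae_abs_deriv_le (a := a)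
      (g := fun t => (3 + 2 * α + 3 * β * K + β) * energyDensity V y t)
      (fun b hb => ?_) (fun t => by positivity)
      (ht₀.trans_le hta) ((hint.mono_set (Ioi_subset_Ioi hta)).const_mul _) ?_ ?_
    · have hid : AbsolutelyContinuousOnInterval (fun t : ℝ => t) a b :=
        contDiff_id.contDiffOn.absolutelyContinuousOnInterval
      exact (hid.fun_smul ((h.ac_velocity b (hta.trans hb)).mono (by
        rw [uIcc_of_le hb, uIcc_of_le (hta.trans hb)]
        exact Icc_subset_Icc_left hta))).norm_sq
    · filter_upwards [h.equation, hy'] with t ht hyt hat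
      have htt : t₀ < t := hta.trans_lt hat
      have ht1 : 1 ≤ t := ha1.trans hat.le
      have ht0 : 0 < t := ht₀.trans htt
      obtain ⟨V', y', hV, hy, heq⟩ := ht htt
      refine ⟨_, ((hasDerivAt_id t).smul hV).norm_sq, ?_⟩
      have h1 := hyt hat y' hy
      have h2 := sq_mul_norm_mul_norm_le (V := V) (y := y) ht0.le
      have hV' : V' = -((α / t) • V t + β • y' + (1 + β / t) • y t) := by
        rw [eq_neg_iff_add_eq_zero, ← heq]
        abel
      have h3 : |⟪V t, y'⟫_ℝ| ≤ ‖V t‖ * (K / t * ‖y t‖ + K / t ^ 2 * ‖V t‖) :=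
        (abs_real_inner_le_norm _ _).trans (by gcongr)
      have h3' : t ^ 2 * |⟪V t, y'⟫_ℝ| ≤ K * (t * (‖V t‖ * ‖y t‖)) + K * ‖V t‖ ^ 2 := by
        calc t ^ 2 * |⟪V t, y'⟫_ℝ|
            ≤ t ^ 2 * (‖V t‖ * (K / t * ‖y t‖ + K / t ^ 2 * ‖V t‖)) := by gcongr
          _ = _ := by field_simp
      have h4 : 2 * ⟪t • V t, t • V' + (1 : ℝ) • V t⟫_ℝ = (2 - 2 * α) * (t * ‖V t‖ ^ 2)
          - (2 * β * (t ^ 2 * ⟪V t, y'⟫_ℝ) + 2 * (t ^ 2 + β * t) * ⟪V t, y t⟫_ℝ) := by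
        rw [hV']
        simp only [inner_add_right, inner_neg_right, inner_smul_left, inner_smul_right,
          RCLike.conj_to_real, real_inner_self_eq_norm_sq]
        field_simp
        ring
      simp only [Pi.smul_apply', id]
      rw [h4]
      have h5 : 0 ≤ t ^ 3 * ‖y t‖ ^ 2 := by positivity
      have h6 : t * ‖V t‖ ^ 2 ≤ energyDensity V y t := by rw [energyDensity]; linarith
      have h7 : t * (‖V t‖ * ‖y t‖) ≤ t ^ 2 * (‖V t‖ * ‖y t‖) := by
        gcongr
        nlinarith
      have h8 : ‖V t‖ ^ 2 ≤ t * ‖V t‖ ^ 2 := le_mul_of_one_le_left (sq_nonneg _) ht1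
      have h9 : |(2 - 2 * α) * (t * ‖V t‖ ^ 2)| ≤ (2 + 2 * α) * energyDensity V y t := by
        rw [abs_mul, abs_of_nonneg (show 0 ≤ t * ‖V t‖ ^ 2 by positivity)]
        refine mul_le_mul ?_ h6 (by positivity) (by positivity)
        rw [abs_le]
        constructor <;> linarith
      have h10 : |2 * β * (t ^ 2 * ⟪V t, y'⟫_ℝ)| ≤ 2 * β * (K * (3 / 2 * energyDensity V y t)) := by
        rw [abs_mul, abs_of_nonneg (show 0 ≤ 2 * β by positivity), abs_mul,
          abs_of_nonneg (sq_nonneg t)]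
        refine mul_le_mul_of_nonneg_left (h3'.trans ?_) (by positivity)
        rw [← mul_add]
        refine mul_le_mul_of_nonneg_left ?_ hK
        linarith
      have h11 : |2 * (t ^ 2 + β * t) * ⟪V t, y t⟫_ℝ| ≤ (1 + β) * energyDensity V y t := by
        rw [abs_mul, abs_of_nonneg (show 0 ≤ 2 * (t ^ 2 + β * t) by positivity)]
        calc 2 * (t ^ 2 + β * t) * |⟪V t, y t⟫_ℝ|
            ≤ 2 * (t ^ 2 + β * t) * (‖V t‖ * ‖y t‖) := by
              gcongr
              exact abs_real_inner_le_norm _ _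
          _ = 2 * (t ^ 2 * (‖V t‖ * ‖y t‖)) + 2 * β * (t * (‖V t‖ * ‖y t‖)) := by ring
          _ ≤ 2 * (energyDensity V y t / 2) + 2 * β * (energyDensity V y t / 2) := by
              gcongr
              exact h7.trans h2
          _ = _ := by ring
      refine (abs_sub _ _).trans ((add_le_add h9 ((abs_add_le _ _).trans
        (add_le_add h10 h11))).trans_eq ?_)
      ring
    · intro t hat
      have ht0 : 0 < t := ht₀.trans (hta.trans_lt hat)
      have h1 : ‖t • V t‖ ^ 2 / t = t * ‖V t‖ ^ 2 := by
        rw [norm_smul, Real.norm_of_nonneg (by positivity)]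
        field_simp
      have h2 : 0 ≤ t ^ 3 * ‖y t‖ ^ 2 := by positivity
      have h3 : 0 ≤ energyDensity V y t := by unfold energyDensity; positivity
      have h4 : 0 ≤ (2 + 2 * α + 3 * β * K + β) * energyDensity V y t := by positivity
      have h5 : t * ‖V t‖ ^ 2 ≤ energyDensity V y t := by rw [energyDensity]; linarith
      rw [h1]
      linarith
  have h := key.sqrt
  simp only [Real.sqrt_sq_eq_abs, abs_norm, Real.sqrt_zero] at h
  refine h.congr' ?_
  filter_upwards [eventually_ge_atTop 0] with t ht
  rw [norm_smul, Real.norm_of_nonneg ht]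

end IsDampedTrajectory

/-- Once `t (V + β y) → 0`, convergence of `lyapunov` is convergence of the distance to `z`. -/
theorem exists_tendsto_norm_sub_sq_of_lyapunov (hσ : 0 < σ) (hσα : σ < α - 1) {z : H} {l : ℝ}
    (hl : Tendsto (lyapunov α β σ x V y z) atTop (𝓝 l))
    (hu : Tendsto (fun t => t • (V t + β • y t)) atTop (𝓝 0)) :
    ∃ d, Tendsto (fun t => ‖x t - z‖ ^ 2) atTop (𝓝 d) := by
  have hκ : 0 < α - 1 - σ := by linarith
  -- The second summand of `lyapunov` bounds the trajectory.
  have hbdd : ∀ᶠ t in atTop, ‖x t - z‖ ≤ Real.sqrt ((l + 1) / (σ * (α - 1 - σ) / 2)) := by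
    filter_upwards [hl.eventually_le_const (lt_add_one l)] with t ht
    apply Real.le_sqrt_of_sq_le
    rw [le_div_iff₀ (by positivity)]
    rw [lyapunov] at ht
    have : 0 ≤ 1 / 2 * ‖σ • (x t - z) + t • (V t + β • y t)‖ ^ 2 := by positivity
    linarith
  have hcross : Tendsto (fun t => ⟪x t - z, t • (V t + β • y t)⟫_ℝ) atTop (𝓝 0) := by
    generalize Real.sqrt _ = C at hbdd
    refine squeeze_zero_norm' (a := fun t => C * ‖t • (V t + β • y t)‖) ?_
      (by simpa using hu.norm.const_mul C)
    filter_upwards [hbdd] with t ht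
    exact (norm_inner_le_norm _ _).trans (by gcongr)
  refine ⟨_, (((hl.sub (hcross.const_mul σ)).sub ((hu.norm.pow 2).const_mul (1 / 2))).const_mul
    (σ * (α - 1) / 2)⁻¹).congr fun t => ?_⟩
  rw [lyapunov, norm_add_sq_real, inner_smul_left, norm_smul σ, mul_pow, Real.norm_eq_abs, sq_abs]
  have h1 : α - 1 ≠ 0 := by linarith
  simp only [RCLike.conj_to_real]
  field_simp
  ring

end Dynamics

/-! ### The Yosida term along a trajectory -/

namespace HRMMD

variable {H : Type*} [NormedAddCommGroup H] [InnerProductSpace ℝ H]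

/-- The velocity of a solution is a continuous derivative, so the position is locally Lipschitz. -/
theorem IsSolution.exists_lipschitzOnWith {A : H → Set H} {α β t₀ : ℝ} {δ γ : ℝ → ℝ} {x : ℝ → H}
    (hx : IsSolution A α β t₀ δ γ x) {T : ℝ} (hT : t₀ ≤ T) :
    ∃ K, LipschitzOnWith K x (Icc t₀ T) := by
  obtain ⟨C, hC⟩ := (hx.velocity_absolutelyContinuous T hT).exists_bound
  rw [uIcc_of_le hT] at hC
  refine ⟨C.toNNReal, (convex_Icc t₀ T).lipschitzOnWith_of_nnnorm_hasDerivWithin_le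
    (fun t ht => ((hx.differentiableOn t ht.1).hasDerivWithinAt.mono Icc_subset_Ici_self)) ?_⟩
  intro t ht
  rw [← NNReal.coe_le_coe, coe_nnnorm]
  exact (hC t ht).trans (Real.le_coe_toNNReal C)

variable [CompleteSpace H] {A : H → Set H} {γ : ℝ → ℝ} {x : ℝ → H}

theorem IsMaximallyMonotone.ac_yosida (hA : IsMaximallyMonotone A) (hzer : (zer A).Nonempty)
    {a b : ℝ} (hab : a ≤ b) (hγ : ContDiffOn ℝ 1 γ (Icc a b)) (hγpos : ∀ t ∈ Icc a b, 0 < γ t)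
    (hx : ∃ K, LipschitzOnWith K x (Icc a b)) :
    AbsolutelyContinuousOnInterval (fun t => yosida A (γ t) (x t)) a b := by
  obtain ⟨z, hz⟩ := hzer
  obtain ⟨Kx, hKx⟩ := hx
  obtain ⟨Kγ, hKγ⟩ := hγ.exists_lipschitzOnWith (by decide) (convex_Icc _ _) isCompact_Icc
  obtain ⟨m, hm, hmin⟩ := isCompact_Icc.exists_isMinOn (nonempty_Icc.mpr hab) hγ.continuousOn
  have hc : 0 < γ m := hγpos m hm
  obtain ⟨R, hR⟩ := isCompact_Icc.exists_bound_of_continuousOn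
    (hKx.continuousOn.sub (continuousOn_const (c := z)))
  have hbd : ∀ t ∈ Icc a b, ‖yosida A (γ t) (x t)‖ ≤ R / γ m := by
    intro t ht
    rw [le_div_iff₀ hc]
    calc ‖yosida A (γ t) (x t)‖ * γ m ≤ ‖yosida A (γ t) (x t)‖ * γ t := by
          gcongr
          exact hmin ht
      _ ≤ ‖x t - z‖ := by
          rw [mul_comm]
          exact hA.mul_norm_yosida_le (hγpos t ht) hz (x t)
      _ ≤ R := hR t ht
  have hR0 : 0 ≤ R / γ m := (norm_nonneg _).trans (hbd m hm)
  refine LipschitzOnWith.absolutelyContinuousOnInterval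
    (K := ((Kx + Kγ * (R / γ m)) / γ m).toNNReal) ?_
  rw [uIcc_of_le hab]
  refine LipschitzOnWith.of_dist_le_mul fun s hs t ht => ?_
  have h1 := hA.mul_norm_yosida_sub_le (hγpos s hs) (hγpos t ht) (x s) (x t)
  have h2 := hKx.dist_le_mul s hs t ht
  have h3 := hKγ.dist_le_mul s hs t ht
  rw [dist_eq_norm] at h2
  rw [Real.dist_eq (γ s)] at h3
  rw [dist_eq_norm]
  calc ‖yosida A (γ s) (x s) - yosida A (γ t) (x t)‖
      ≤ (Kx + Kγ * (R / γ m)) / γ m * dist s t := by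
        rw [div_mul_eq_mul_div, le_div_iff₀ hc]
        calc ‖yosida A (γ s) (x s) - yosida A (γ t) (x t)‖ * γ m
            ≤ γ s * ‖yosida A (γ s) (x s) - yosida A (γ t) (x t)‖ := by
              rw [mul_comm]
              gcongr
              exact hmin hs
          _ ≤ Kx * dist s t + Kγ * dist s t * (R / γ m) := by
              refine h1.trans (add_le_add h2 ?_)
              exact mul_le_mul h3 (hbd t ht) (norm_nonneg _) (by positivity)
          _ = _ := by ring
    _ ≤ _ := by
        gcongr
        exact Real.le_coe_toNNReal _

/-- The Lipschitz estimate `mul_norm_yosida_sub_le`, differentiated along a curve. -/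
theorem IsMaximallyMonotone.mul_norm_deriv_yosida_le (hA : IsMaximallyMonotone A) {t γ' : ℝ}
    {V a' : H} (hγpos : ∀ᶠ s in 𝓝 t, 0 < γ s) (hx : HasDerivAt x V t) (hγ : HasDerivAt γ γ' t)
    (ha : HasDerivAt (fun s => yosida A (γ s) (x s)) a' t) :
    γ t * ‖a'‖ ≤ ‖V‖ + |γ'| * ‖yosida A (γ t) (x t)‖ := by
  have h1 := (hγ.continuousAt.tendsto.mono_left nhdsWithin_le_nhds).mul ha.tendsto_slope.norm
  have h2 := hx.tendsto_slope.norm.add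
    (hγ.tendsto_slope.norm.mul_const ‖yosida A (γ t) (x t)‖)
  refine le_of_tendsto_of_tendsto h1 h2 ?_
  filter_upwards [mem_nhdsWithin_of_mem_nhds hγpos, self_mem_nhdsWithin] with s hs hst
  have h3 := mul_le_mul_of_nonneg_left
    (hA.mul_norm_yosida_sub_le hs hγpos.self_of_nhds (x s) (x t)) (norm_nonneg (s - t)⁻¹)
  simp only [slope_def_module, norm_smul, Real.norm_eq_abs (γ s - γ t)]
  linarith

/-- Slow variation of the parameters makes the rescaled Yosida term vary slowly. -/
theorem IsMaximallyMonotone.norm_deriv_smul_yosida_le (hA : IsMaximallyMonotone A)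
    {δ : ℝ → ℝ} {t δ' γ' M N c : ℝ} {V y' : H}
    (hδpos : ∀ᶠ s in 𝓝 t, 0 < δ s) (hγpos : ∀ᶠ s in 𝓝 t, 0 < γ s)
    (hx : HasDerivAt x V t) (hδ : HasDerivAt δ δ' t) (hγ : HasDerivAt γ γ' t)
    (hy : HasDerivAt (fun s => δ s • yosida A (γ s) (x s)) y' t)
    (hM : |δ'| / δ t ≤ M / t) (hN : |γ'| / γ t ≤ N / t) (hc : δ t / γ t ≤ c / t ^ 2) :
    ‖y'‖ ≤ (M + N) / t * ‖δ t • yosida A (γ t) (x t)‖ + c / t ^ 2 * ‖V‖ := by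
  have hδt : 0 < δ t := hδpos.self_of_nhds
  have hγt : 0 < γ t := hγpos.self_of_nhds
  have hdiff : DifferentiableAt ℝ (fun s => yosida A (γ s) (x s)) t := by
    refine ((hδ.differentiableAt.inv hδt.ne').smul hy.differentiableAt).congr_of_eventuallyEq ?_
    filter_upwards [hδpos] with s hs
    exact (inv_smul_smul₀ hs.ne' _).symm
  obtain ⟨a', ha⟩ : ∃ a', HasDerivAt (fun s => yosida A (γ s) (x s)) a' t := ⟨_, hdiff.hasDerivAt⟩
  have h1 := hA.mul_norm_deriv_yosida_le hγpos hx hγ ha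
  have h2 : y' = δ t • a' + δ' • yosida A (γ t) (x t) := hy.unique (hδ.smul ha)
  generalize yosida A (γ t) (x t) = u at *
  have h3 : ‖a'‖ ≤ (‖V‖ + |γ'| * ‖u‖) / γ t := by
    rw [le_div_iff₀ hγt]
    linarith
  rw [norm_smul, Real.norm_of_nonneg hδt.le]
  calc ‖y'‖ ≤ δ t * ‖a'‖ + |δ'| * ‖u‖ := by
        rw [h2]
        refine (norm_add_le _ _).trans_eq ?_
        rw [norm_smul, norm_smul, Real.norm_of_nonneg hδt.le, Real.norm_eq_abs]
    _ ≤ δ t * ((‖V‖ + |γ'| * ‖u‖) / γ t) + |δ'| * ‖u‖ := by gcongr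
    _ = (|δ'| / δ t + |γ'| / γ t) * (δ t * ‖u‖) + δ t / γ t * ‖V‖ := by
        field_simp
        ring
    _ ≤ (M / t + N / t) * (δ t * ‖u‖) + c / t ^ 2 * ‖V‖ := by gcongr
    _ = _ := by rw [add_div]

theorem IsSolution.isDampedTrajectory (hA : IsMaximallyMonotone A) (hzer : (zer A).Nonempty)
    {α β t₀ : ℝ} {δ : ℝ → ℝ} (hδ : ContDiffOn ℝ 1 δ (Ici t₀)) (hγ : ContDiffOn ℝ 1 γ (Ici t₀))
    (hγpos : ∀ t ∈ Ici t₀, 0 < γ t) (hx : IsSolution A α β t₀ δ γ x) :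
    IsDampedTrajectory α β t₀ x (derivWithin x (Ici t₀))
      (fun t => δ t • yosida A (γ t) (x t)) where
  hasDerivAt t ht := (hx.differentiableOn t ht.le).hasDerivWithinAt.hasDerivAt (Ici_mem_nhds ht)
  ac_position T hT := by
    obtain ⟨K, hK⟩ := hx.exists_lipschitzOnWith hT
    rw [← uIcc_of_le hT] at hK
    exact hK.absolutelyContinuousOnInterval
  ac_velocity := hx.velocity_absolutelyContinuous
  ac_forcing T hT := by
    have h1 : AbsolutelyContinuousOnInterval δ t₀ T := by
      refine ContDiffOn.absolutelyContinuousOnInterval (hδ.mono ?_)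
      rw [uIcc_of_le hT]
      exact Icc_subset_Ici_self
    exact h1.fun_smul (hA.ac_yosida hzer hT (hγ.mono Icc_subset_Ici_self)
      (fun t ht => hγpos t ht.1) (hx.exists_lipschitzOnWith hT))
  equation := by
    filter_upwards [(ae_restrict_iff' measurableSet_Ici).mp hx.equation] with t ht htt
    obtain ⟨h1, h2, h3⟩ := ht htt.le
    refine ⟨_, _, h1.hasDerivWithinAt.hasDerivAt (Ici_mem_nhds htt),
      h2.hasDerivWithinAt.hasDerivAt (Ici_mem_nhds htt), ?_⟩
    rwa [smul_smul]

end HRMMD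

/-! ### Decay estimates and weak cluster points along solutions -/

namespace HRMMD

variable {H : Type*} [NormedAddCommGroup H] [InnerProductSpace ℝ H] [CompleteSpace H]
  {A : H → Set H} {α β t₀ : ℝ} {δ γ : ℝ → ℝ} {x : ℝ → H}

/-- The derivative bound for `y = δ A_γ x` required by
`IsDampedTrajectory.tendsto_sq_mul_norm_forcing`. The limit hypothesis enters through `δ/γ ≤ (2/L)/t²`. -/
theorem eventually_norm_deriv_forcing_le (hA : IsMaximallyMonotone A)
    (hδ : ContDiffOn ℝ 1 δ (Ici t₀)) (hγ : ContDiffOn ℝ 1 γ (Ici t₀))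
    (hδpos : ∀ t ∈ Ici t₀, 0 < δ t) (hγpos : ∀ t ∈ Ici t₀, 0 < γ t)
    {L : ℝ} (hL : 0 < L) (hlim : Tendsto (fun t => γ t / (t ^ 2 * δ t)) atTop (𝓝 L))
    {M : ℝ} (hM : 0 < M) (hδ' : ∀ᶠ t in atTop,
      0 < t * derivWithin δ (Ici t₀) t / δ t ∧ t * derivWithin δ (Ici t₀) t / δ t ≤ M)
    (hγ' : (fun t => |derivWithin γ (Ici t₀) t| / γ t) =O[atTop] (fun t => 1 / t))
    (hx : IsSolution A α β t₀ δ γ x) :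
    ∃ K, 0 ≤ K ∧ ∀ᶠ t in atTop, ∀ y',
      HasDerivAt (fun s => δ s • yosida A (γ s) (x s)) y' t →
      ‖y'‖ ≤ K / t * ‖δ t • yosida A (γ t) (x t)‖ + K / t ^ 2 * ‖derivWithin x (Ici t₀) t‖ := by
  obtain ⟨N, hN0, hN⟩ := hγ'.exists_pos
  refine ⟨max (M + N) (2 / L), le_max_of_le_left (by positivity), ?_⟩
  filter_upwards [hδ', hN.bound, hlim.eventually_const_le (half_lt_self hL), eventually_gt_atTop 0,
    eventually_gt_atTop t₀] with t hδt hγt hLt ht0 htt y' hy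
  have hδp : 0 < δ t := hδpos t htt.le
  have hγp : 0 < γ t := hγpos t htt.le
  have hnear : ∀ᶠ s in 𝓝 t, s ∈ Ici t₀ := Ici_mem_nhds htt
  have hd : ∀ {f : ℝ → ℝ}, ContDiffOn ℝ 1 f (Ici t₀) →
      HasDerivAt f (derivWithin f (Ici t₀) t) t := fun hf =>
    ((hf.differentiableOn (by decide)) t htt.le).hasDerivWithinAt.hasDerivAt (Ici_mem_nhds htt)
  refine (hA.norm_deriv_smul_yosida_le (M := M) (N := N) (c := 2 / L) (hnear.mono hδpos)
    (hnear.mono hγpos)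
    ((hx.differentiableOn t htt.le).hasDerivWithinAt.hasDerivAt (Ici_mem_nhds htt)) (hd hδ) (hd hγ)
    hy ?_ ?_ ?_).trans ?_
  · have h1 : 0 < derivWithin δ (Ici t₀) t := by
      by_contra! h
      have : t * derivWithin δ (Ici t₀) t / δ t ≤ 0 :=
        div_nonpos_of_nonpos_of_nonneg (mul_nonpos_of_nonneg_of_nonpos ht0.le h) hδp.le
      linarith [hδt.1]
    rw [abs_of_pos h1, le_div_iff₀ ht0]
    calc _ = t * derivWithin δ (Ici t₀) t / δ t := by ring
      _ ≤ M := hδt.2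
  · rw [Real.norm_of_nonneg (by positivity), Real.norm_of_nonneg (by positivity)] at hγt
    exact hγt.trans_eq (mul_one_div _ _)
  · rw [le_div_iff₀ (by positivity)] at hLt
    rw [div_le_div_iff₀ hγp (by positivity), div_mul_eq_mul_div, le_div_iff₀ hL]
    linarith
  · gcongr
    · exact le_max_left _ _
    · exact le_max_right _ _

/-- Weak cluster points are zeros of `A`: the resolvent `J_{γ A} x = x - γ A_γ x` has
the same weak limits as `x`, and `A_γ x → 0` is a value of `A` at it. -/
theorem IsMaximallyMonotone.mem_zer_of_yosida (hA : IsMaximallyMonotone A) {ι : Type*}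
    {l : Filter ι} [l.NeBot] {lam : ι → ℝ} {x : ι → H} {z p : H} {C : ℝ} (hz : z ∈ zer A)
    (hlam : ∀ᶠ t in l, 0 < lam t) (hbdd : ∀ᶠ t in l, ‖x t - z‖ ≤ C)
    (hxp : ∀ w, Tendsto (fun t => ⟪x t, w⟫_ℝ) l (𝓝 ⟪p, w⟫_ℝ))
    (ha : Tendsto (fun t => yosida A (lam t) (x t)) l (𝓝 0))
    (hlama : Tendsto (fun t => lam t • yosida A (lam t) (x t)) l (𝓝 0)) : p ∈ zer A := by
  refine hA.mem_zer_of_weak_limit (J := fun t => x t - lam t • yosida A (lam t) (x t))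
    (C := C + ‖z‖ + C) (hlam.mono fun t ht => hA.yosida_mem ht (x t)) ?_ (fun w => ?_) ha
  · filter_upwards [hlam, hbdd] with t ht hb
    have h1 : ‖lam t • yosida A (lam t) (x t)‖ ≤ C := by
      rw [norm_smul, Real.norm_of_nonneg ht.le]
      exact (hA.mul_norm_yosida_le ht hz (x t)).trans hb
    have h2 : ‖x t‖ ≤ ‖x t - z‖ + ‖z‖ := by
      simpa using norm_add_le (x t - z) z
    exact (norm_sub_le _ _).trans (by linarith)
  · have h := (hxp w).sub (hlama.inner (tendsto_const_nhds (x := w)))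
    simpa only [inner_sub_left, inner_zero_left, sub_zero] using h

theorem eventually_const_le_of_derivWithin_pos (hδ : ContDiffOn ℝ 1 δ (Ici t₀))
    (hδpos : ∀ t ∈ Ici t₀, 0 < δ t)
    (hδ' : ∀ᶠ t in atTop, 0 < derivWithin δ (Ici t₀) t) :
    ∃ c, 0 < c ∧ ∀ᶠ t in atTop, c ≤ δ t := by
  obtain ⟨T, hT⟩ := eventually_atTop.mp (hδ'.and (eventually_gt_atTop t₀))
  have hTt : t₀ < T := (hT T le_rfl).2
  refine ⟨δ T, hδpos T hTt.le, eventually_atTop.mpr ⟨T, fun t ht => ?_⟩⟩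
  have hsub : Ici T ⊆ Ici t₀ := Ici_subset_Ici.mpr hTt.le
  have hmono : MonotoneOn δ (Ici T) := by
    refine monotoneOn_of_deriv_nonneg (convex_Ici T) (hδ.continuousOn.mono hsub)
      ((hδ.differentiableOn (by decide)).mono (interior_subset.trans hsub)) fun s hs => ?_
    have hTs : T ≤ s := interior_subset hs
    rw [← derivWithin_of_mem_nhds (Ici_mem_nhds (hTt.trans_le hTs))]
    exact (hT s hTs).1.le
  exact hmono self_mem_Ici ht ht

end HRMMD

/-! ### Asymptotics of the trajectories -/

theorem mainTheorem2
    {H : Type*} [NormedAddCommGroup H] [InnerProductSpace ℝ H] [CompleteSpace H]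
    (A : H → Set H) (hA : HRMMD.IsMaximallyMonotone A) (hzer : (HRMMD.zer A).Nonempty)
    (α β σ t₀ : ℝ) (hα : 1 < α) (hβ : 0 < β) (hσ : 0 < σ) (hσα : σ < α - 1) (ht₀ : 0 < t₀)
    (δ γ : ℝ → ℝ)
    (hδ : ContDiffOn ℝ 1 δ (Ici t₀)) (hγ : ContDiffOn ℝ 1 γ (Ici t₀))
    (hδpos : ∀ t ∈ Ici t₀, 0 < δ t) (hγpos : ∀ t ∈ Ici t₀, 0 < γ t)
    (hlim : ∃ L : ℝ, Tendsto (fun t => γ t / (t ^ 2 * δ t)) atTop (𝓝 L) ∧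
      1 / (4 * (α - σ - 1) * σ) < L)
    (hδ' : ∃ M : ℝ, 0 < M ∧ ∀ᶠ t in atTop,
      0 < t * derivWithin δ (Ici t₀) t / δ t ∧ t * derivWithin δ (Ici t₀) t / δ t ≤ M)
    (hγ' : (fun t => |derivWithin γ (Ici t₀) t| / γ t) =O[atTop] (fun t => 1 / t))
    (x : ℝ → H) (hx : HRMMD.IsSolution A α β t₀ δ γ x) :
    (fun t => ‖HRMMD.yosida A (γ t) (x t)‖) =o[atTop] (fun t => 1 / (t ^ 2 * δ t)) ∧
    (fun t => ‖derivWithin x (Ici t₀) t‖) =o[atTop] (fun t => 1 / t) ∧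
    IntegrableOn (fun t => t * ‖derivWithin x (Ici t₀) t‖ ^ 2) (Ici t₀) volume ∧
    IntegrableOn (fun t => t ^ 3 * δ t ^ 2 * ‖HRMMD.yosida A (γ t) (x t)‖ ^ 2) (Ici t₀) volume ∧
    ∃ xlim ∈ HRMMD.zer A,
      Tendsto (fun t => toWeakSpace ℝ H (x t)) atTop (𝓝 (toWeakSpace ℝ H xlim)) := by
  obtain ⟨L, hlim, hL⟩ := hlim
  obtain ⟨M, hM, hδ'⟩ := hδ'
  have hL0 : 0 < L := lt_trans (by
    have : 0 < α - σ - 1 := by linarith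
    positivity) hL
  have hdamped := hx.isDampedTrajectory hA hzer hδ hγ hγpos
  obtain ⟨K, hK, hy'⟩ := HRMMD.eventually_norm_deriv_forcing_le hA hδ hγ hδpos hγpos hL0 hlim hM
    hδ' hγ' hx
  have hδ'pos : ∀ᶠ t in atTop, 0 < derivWithin δ (Ici t₀) t := by
    filter_upwards [hδ', eventually_ge_atTop t₀, eventually_gt_atTop 0] with t ht htt ht0
    have h1 := (div_pos_iff_of_pos_right (hδpos t htt)).mp ht.1
    exact pos_of_mul_pos_right h1 ht0.le
  obtain ⟨c, hc, hδc⟩ := HRMMD.eventually_const_le_of_derivWithin_pos hδ hδpos hδ'pos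
  obtain ⟨V, hV⟩ : ∃ V, V = derivWithin x (Ici t₀) := ⟨_, rfl⟩
  obtain ⟨y, hy⟩ : ∃ y : ℝ → H, y = fun t => δ t • HRMMD.yosida A (γ t) (x t) := ⟨_, rfl⟩
  rw [← hV] at hdamped hy' ⊢
  rw [← hy] at hdamped hy'
  have hyn : ∀ t, t₀ ≤ t → ‖y t‖ = δ t * ‖HRMMD.yosida A (γ t) (x t)‖ := fun t ht => by
    rw [hy, norm_smul, Real.norm_of_nonneg (hδpos t ht).le]
  have hpos : ∀ t, t₀ ≤ t → 0 < t := fun t ht => ht₀.trans_le ht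
  have hlyap : ∀ z ∈ HRMMD.zer A, (∃ l, Tendsto (lyapunov α β σ x V y z) atTop (𝓝 l)) ∧
      IntegrableOn (energyDensity V y) (Ioi t₀) := by
    intro z hz
    refine hdamped.exists_tendsto_lyapunov_and_integrableOn ht₀ hβ hσ hσα hL
      (θ := fun t => γ t / δ t) (hlim.congr fun t => ?_) fun t ht => ?_
    · rw [div_div, mul_comm]
    -- Cocoercivity of `A_γ` with modulus `γ` is cocoercivity of `y = δ A_γ x` with modulus `γ / δ`.
    · have h1 := hA.mul_norm_yosida_sq_le (hγpos t ht) hz (x t)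
      have hδt := hδpos t ht
      rw [hyn t ht, hy]
      simp only [inner_smul_right]
      calc γ t / δ t * (δ t * ‖HRMMD.yosida A (γ t) (x t)‖) ^ 2
          = δ t * (γ t * ‖HRMMD.yosida A (γ t) (x t)‖ ^ 2) := by field_simp
        _ ≤ _ := by gcongr
  obtain ⟨z, hz⟩ := hzer
  obtain ⟨-, hint⟩ := hlyap z hz
  obtain ⟨T, hT⟩ := eventually_atTop.mp hy'
  obtain ⟨a, ha⟩ : ∃ a, a = max (max t₀ 1) T := ⟨_, rfl⟩
  have hta : t₀ ≤ a := ha ▸ (le_max_left _ _).trans (le_max_left _ _)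
  have ha1 : 1 ≤ a := ha ▸ (le_max_right _ _).trans (le_max_left _ _)
  have hy'a : ∀ᵐ t, a < t → ∀ y', HasDerivAt y y' t →
      ‖y'‖ ≤ K / t * ‖y t‖ + K / t ^ 2 * ‖V t‖ := by
    refine Eventually.of_forall fun t hat => ?_
    have := hT t ((ha ▸ le_max_right _ _ : T ≤ a).trans hat.le)
    simpa only [hy] using this
  have hylim := hdamped.tendsto_sq_mul_norm_forcing ht₀ hta hK hint hy'a
  have hVlim := hdamped.tendsto_mul_norm_velocity ht₀ (by linarith) hβ.le hta ha1 hK hint hy'a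
  have hVc := continuousOn_Ici_of_absolutelyContinuous hdamped.ac_velocity
  have hyc := continuousOn_Ici_of_absolutelyContinuous hdamped.ac_forcing
  rw [← integrableOn_Ici_iff_integrableOn_Ioi] at hint
  refine ⟨?_, ?_, ?_, ?_, ?_⟩
  · refine isLittleO_iff_exists_eq_mul.mpr ⟨_, hylim, ?_⟩
    filter_upwards [eventually_ge_atTop t₀] with t ht
    have h1 := hpos t ht
    have h2 := hδpos t ht
    simp only [Pi.mul_apply]
    rw [hyn t ht]
    field_simp
  · refine isLittleO_iff_exists_eq_mul.mpr ⟨_, hVlim, ?_⟩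
    filter_upwards [eventually_ge_atTop t₀] with t ht
    have h1 := hpos t ht
    simp only [Pi.mul_apply]
    field_simp
  · refine hint.mono' (ContinuousOn.aestronglyMeasurable (by fun_prop) measurableSet_Ici) ?_
    rw [ae_restrict_iff' measurableSet_Ici]
    refine Eventually.of_forall fun t ht => ?_
    have h1 := hpos t ht
    have h2 : 0 ≤ t ^ 3 * ‖y t‖ ^ 2 := by positivity
    rw [Real.norm_of_nonneg (by positivity), energyDensity]
    linarith
  · have h3 : IntegrableOn (fun t => t ^ 3 * ‖y t‖ ^ 2) (Ici t₀) := by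
      refine hint.mono' (ContinuousOn.aestronglyMeasurable (by fun_prop) measurableSet_Ici) ?_
      rw [ae_restrict_iff' measurableSet_Ici]
      refine Eventually.of_forall fun t ht => ?_
      have h1 := hpos t ht
      have h2 : 0 ≤ t * ‖V t‖ ^ 2 := by positivity
      rw [Real.norm_of_nonneg (by positivity), energyDensity]
      linarith
    refine h3.congr_fun (fun t ht => ?_) measurableSet_Ici
    simp only
    rw [hyn t ht]
    ring
  · have hylim' : Tendsto (fun t => ‖y t‖) atTop (𝓝 0) := by
      refine squeeze_zero' (Eventually.of_forall fun t => norm_nonneg _) ?_ hylim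
      filter_upwards [eventually_ge_atTop 1] with t ht
      exact le_mul_of_one_le_left (norm_nonneg _) (one_le_pow₀ ht)
    have hu : Tendsto (fun t => t • (V t + β • y t)) atTop (𝓝 0) := by
      have h1 : Tendsto (fun t => t * ‖V t‖ + β * (t ^ 2 * ‖y t‖)) atTop (𝓝 0) := by
        simpa using hVlim.add (hylim.const_mul β)
      refine squeeze_zero_norm' ?_ h1
      filter_upwards [eventually_ge_atTop 1] with t ht
      have ht0 : 0 ≤ t := zero_le_one.trans ht
      rw [norm_smul, Real.norm_of_nonneg ht0]
      calc t * ‖V t + β • y t‖ ≤ t * (‖V t‖ + β * ‖y t‖) := by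
            gcongr
            refine (norm_add_le _ _).trans_eq ?_
            rw [norm_smul, Real.norm_of_nonneg hβ.le]
        _ = t * ‖V t‖ + β * (t * ‖y t‖) := by ring
        _ ≤ t * ‖V t‖ + β * (t ^ 2 * ‖y t‖) := by
            gcongr
            nlinarith
    have hdist : ∀ z ∈ HRMMD.zer A, ∃ d, Tendsto (fun t => ‖x t - z‖ ^ 2) atTop (𝓝 d) := by
      intro z hz
      obtain ⟨l, hl⟩ := (hlyap z hz).1
      exact exists_tendsto_norm_sub_sq_of_lyapunov hσ hσα hl hu
    obtain ⟨d, hd⟩ := hdist z hz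
    have hbdd : ∀ᶠ t in atTop, ‖x t - z‖ ≤ Real.sqrt (d + 1) := by
      filter_upwards [hd.eventually_le_const (lt_add_one d)] with t ht
      exact Real.le_sqrt_of_sq_le ht
    have hyos : Tendsto (fun t => HRMMD.yosida A (γ t) (x t)) atTop (𝓝 0) := by
      refine squeeze_zero_norm' (a := fun t => c⁻¹ * ‖y t‖) ?_ (by simpa using hylim'.const_mul c⁻¹)
      filter_upwards [hδc, eventually_ge_atTop t₀] with t htc ht
      rw [hyn t ht, ← div_eq_inv_mul, le_div_iff₀ hc, mul_comm]
      gcongr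
    -- `γ A_γ x = (γ / (t² δ)) (t² y)`, a convergent factor times one tending to `0`.
    have hγyos : Tendsto (fun t => γ t • HRMMD.yosida A (γ t) (x t)) atTop (𝓝 0) := by
      refine squeeze_zero_norm' (a := fun t => γ t / (t ^ 2 * δ t) * (t ^ 2 * ‖y t‖)) ?_
        (by simpa using hlim.mul hylim)
      filter_upwards [eventually_ge_atTop t₀] with t ht
      have h1 := hpos t ht
      have h2 := hδpos t ht
      rw [norm_smul, Real.norm_of_nonneg (hγpos t ht).le, hyn t ht]
      apply le_of_eq
      field_simp
    obtain ⟨p, hp, hweak⟩ := exists_weak_limit_of_opial ⟨z, hz⟩ hdist fun U hU p hp =>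
      hA.mem_zer_of_yosida hz (hU ((eventually_ge_atTop t₀).mono hγpos)) (hU hbdd) hp
        (hyos.mono_left hU) (hγyos.mono_left hU)
    exact ⟨p, hp, tendsto_toWeakSpace_of_forall_inner hweak⟩
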